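/- Let $r,K$ be integers with $2\le r\le K-1$. A file consists of $N\ge 1$ bits. An $r$-balanced database of the file on a finite set $V$ of nodes assigns to every node $i\in V$ the set $C_i$ of the bits that it stores, such that every bit is stored at exactly $r$ nodes and all $|C_i|$ are equal. The following operations are considered for an $r$-balanced database $\mathcal C=(C_i)$ on $[K]=\{1,\dots,K\}$. *Removal of node $k$.* The target is an $r$-balanced database $(C_i(k))$ on $[K]\setminus\{k\}$. Each surviving node $i$ broadcasts a codeword of $l_i\ge 1$ bits that is a function of its contents $C_i$; each survivor $i$ must recover $C_i(k)$, for every possible value of the file, from $C_i$ and the codewords of the other survivors. The load is $L_{\rm rem}=\sum_i l_i/|C_k|$. *Addition of an empty node $K+1$.* The target is an $r$-balanced database $(C_i')$ on $[K+1]$. Each node $i\in[K]$ broadcasts a codeword of $l_i\ge1$ bits that is a function of $C_i$; each $i\in[K]$ must recover $C_i'$ from $C_i$ and the codewords of the other old nodes, and the new node must recover $C_{K+1}'$ from the codewords alone. The load is $L_{\rm add}=\sum_i l_i/|C_{K+1}'|$. The rebalancing load of an $r$-balanced database on $[K]$, targets and schemes for the removal of each $k\in[K]$, and a target and scheme for the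 addition of a node, is the maximum over $k$ of the removal loads plus the addition load. Let $L^*(r)$ be the infimum of the rebalancing load over all such choices. For $|V|\ge r$, call a database on $V$ *structured* if the file can be partitioned into equally large subfiles $W_{\mathbf i}$, indexed by the vectors $\mathbf i$ of $|V|-r$ distinct elements of $V$, such that node $m$ stores $W_{\mathbf i}$ if and only if $m$ is not an entry of $\mathbf i$. **Theorem.** (Achievability) Let $N\ge1$ be a multiple of $(r-1)\,(K+1)!/r!$. Then structured databases on $[K]$ exist, and every structured database on $[K]$ is $r$-balanced and has the following properties. For each $k\in[K]$ there are a structured $r$-balanced target on $[K]\setminus\{k\}$ and a removal scheme of load exactly $\frac1{r-1}$ in which each transmitted bit is the XOR of $r-1$ bits stored both at the sender and at node $k$, each of which is to be newly stored at some survivor that already stores the other $r-2$. There are a structured $r$-balanced target on $[K+1]$ and an addition scheme of load exactly $1$. In particular the rebalancing load $\frac1{r-1}+1$ is achieved, and it is the infimum of the rebalancing loads for these $K$ and $N$. (Converse) For every $N\ge1$, every choice of $r$-balanced initial and target databases and of rebalancing schemes as above has rebalancing load at least $\frac1{r-1}+1$. Consequently $L^*(r)=\frac{1}{r-1}+1$,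 whether the infimum is taken over all $N\ge1$ for the given $K$, or over all $K\ge r+1$ and all $N\ge1$. -/

import Mathlib

namespace CodedRebalancing

/-- A binary digit. Addition in `ZMod 2` is XOR. -/
abbrev Bit : Type := ZMod 2

/-- The contents of a file of `N` bits. -/
abbrev File (N : ℕ) : Type := Fin N → Bit

/-- A distributed database of a file of `N` bits on the set of nodes `V`: node `i` stores the bits
whose positions lie in `store i`, and every bit is stored somewhere. -/
structure Database (V : Type) (N : ℕ) where
  store : V → Finset (Fin N)
  cover : ∀ n, ∃ i, n ∈ store i

namespace Database

variable {V : Type} {N : ℕ}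

/-- The possible contents of the storage of node `i`. -/
abbrev Contents (C : Database V N) (i : V) : Type := C.store i → Bit

/-- The actual contents of node `i` when the file is `W`. -/
def read (C : Database V N) (i : V) (W : File N) : C.Contents i := fun n => W n.1

/-- The replication factor of the `n`-th bit in a set `B` of nodes. -/
def replication (C : Database V N) (B : Finset V) (n : Fin N) : ℕ :=
  (B.filter fun k => n ∈ C.store k).card

/-- `r`-balanced databases: each bit is stored on exactly `r` nodes, and all nodes store the same
number of bits. -/
structure IsBalanced [Fintype V] (r : ℕ) (C : Database V N) : Prop where
  replication_eq : ∀ n, C.replication Finset.univ n = r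
  card_store_eq : ∀ i j, (C.store i).card = (C.store j).card

/-- The structured class of databases with parameter `r` on a set `V` of `r` or more nodes. The file
is partitioned into subfiles of equal size, one for each vector of length `|V| - r` with distinct
entries from `V` (`index n` is the vector of the subfile that contains the `n`-th bit), and a node
stores a subfile iff it does not occur in its vector. -/
def IsStructured [Fintype V] (r : ℕ) (C : Database V N) : Prop :=
  r ≤ Fintype.card V ∧
  ∃ index : Fin N → (Fin (Fintype.card V - r) ↪ V),
    (∀ n i, n ∈ C.store i ↔ i ∉ Set.range (index n)) ∧
    ∀ v w, {n | index n = v}.ncard = {n | index n = w}.ncard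

end Database

/-- A rebalancing scheme for the removal of node `k` from the nodes of `C`, with target database `T`
on the surviving nodes. Survivor `i` broadcasts a codeword of `len i` bits, a function of its own
contents; from its own contents and the codewords of the other survivors it computes its contents in
the target database, whatever the file is. -/
structure RemovalScheme {K N : ℕ} (C : Database (Fin K) N) (k : Fin K)
    (T : Database {i : Fin K // i ≠ k} N) where
  len : {i : Fin K // i ≠ k} → ℕ
  len_pos : ∀ i, 0 < len i
  encode : ∀ i : {i : Fin K // i ≠ k}, C.Contents i.1 → (Fin (len i) → Bit)
  decode : ∀ i : {i : Fin K // i ≠ k}, C.Contents i.1 →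
    (∀ j : {j : {i : Fin K // i ≠ k} // j ≠ i}, Fin (len j.1) → Bit) → T.Contents i
  decode_correct : ∀ (i : {i : Fin K // i ≠ k}) (W : File N),
    decode i (C.read i.1 W) (fun j => encode j.1 (C.read j.1.1 W)) = T.read i W

namespace RemovalScheme

variable {K N : ℕ} {C : Database (Fin K) N} {k : Fin K} {T : Database {i : Fin K // i ≠ k} N}

/-- The number of transmitted bits, divided by the number of bits of the removed node. -/
noncomputable def load (R : RemovalScheme C k T) : ℝ :=
  (∑ i, (R.len i : ℝ)) / ((C.store k).card : ℝ)

/-- The scheme is a coded (XOR) data exchange with parameter `r`: every transmitted bit is the XOR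
of `r - 1` bits that are stored both at the sender and at the removed node, such that each of them
is to be newly stored at a survivor which already stores all the others. -/
def IsXorExchange (r : ℕ) (R : RemovalScheme C k T) : Prop :=
  ∀ (i : {i : Fin K // i ≠ k}) (t : Fin (R.len i)), ∃ A : Finset (Fin N),
    A ⊆ C.store i.1 ∩ C.store k ∧ A.card = r - 1 ∧
    (∀ n ∈ A, ∃ j : {i : Fin K // i ≠ k},
      n ∈ T.store j ∧ n ∉ C.store j.1 ∧ ∀ m ∈ A, m ≠ n → m ∈ C.store j.1) ∧
    ∀ W : File N, R.encode i (C.read i.1 W) t = ∑ n ∈ A, W n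

end RemovalScheme

/-- A rebalancing scheme for the addition of an empty node, with target database `T`. The old nodes
are `i.castSucc` for `i : Fin K`, and the new node is `Fin.last K`. Each old node broadcasts a
function of its contents; the old nodes decode from their own contents and the codewords of the
other old nodes, the new node decodes from the codewords alone. -/
structure AdditionScheme {K N : ℕ} (C : Database (Fin K) N) (T : Database (Fin (K + 1)) N) where
  len : Fin K → ℕ
  len_pos : ∀ i, 0 < len i
  encode : ∀ i : Fin K, C.Contents i → (Fin (len i) → Bit)
  decode : ∀ i : Fin K, C.Contents i →
    (∀ j : {j : Fin K // j ≠ i}, Fin (len j.1) → Bit) → T.Contents i.castSucc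
  decodeNew : (∀ j : Fin K, Fin (len j) → Bit) → T.Contents (Fin.last K)
  decode_correct : ∀ (i : Fin K) (W : File N),
    decode i (C.read i W) (fun j => encode j.1 (C.read j.1 W)) = T.read i.castSucc W
  decodeNew_correct : ∀ W : File N,
    decodeNew (fun j => encode j (C.read j W)) = T.read (Fin.last K) W

/-- The number of transmitted bits, divided by the number of bits of the new node. -/
noncomputable def AdditionScheme.load {K N : ℕ} {C : Database (Fin K) N}
    {T : Database (Fin (K + 1)) N} (R : AdditionScheme C T) : ℝ :=
  (∑ i, (R.len i : ℝ)) / ((T.store (Fin.last K)).card : ℝ)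

/-- A choice of `r`-balanced initial and target databases for a file of `N` bits on `K` nodes,
together with rebalancing schemes for the removal of each node and for the addition of a node. -/
structure Design (r K N : ℕ) where
  initial : Database (Fin K) N
  afterRemoval : ∀ k : Fin K, Database {i : Fin K // i ≠ k} N
  afterAddition : Database (Fin (K + 1)) N
  initial_balanced : initial.IsBalanced r
  afterRemoval_balanced : ∀ k, (afterRemoval k).IsBalanced r
  afterAddition_balanced : afterAddition.IsBalanced r
  removal : ∀ k, RemovalScheme initial k (afterRemoval k)
  addition : AdditionScheme initial afterAddition

/-- The rebalancing load: the largest removal load plus the addition load. -/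
noncomputable def Design.load {r K N : ℕ} (D : Design r K N) : ℝ :=
  (⨆ k : Fin K, (D.removal k).load) + D.addition.load

/-- The rebalancing loads for replication factor `r` on `K` nodes and file size `N`. -/
def loads (r K N : ℕ) : Set ℝ := Set.range fun D : Design r K N => D.load

/-- The optimal rebalancing load for replication factor `r` on `K` nodes, over all file sizes. -/
noncomputable def optimalLoadOn (r K : ℕ) : ℝ :=
  sInf {L | ∃ N, 0 < N ∧ L ∈ loads r K N}

/-- The optimal rebalancing load `L*(r)`, over all numbers of nodes and all file sizes. -/
noncomputable def optimalLoad (r : ℕ) : ℝ :=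
  sInf {L | ∃ K N, r + 1 ≤ K ∧ 0 < N ∧ L ∈ loads r K N}

end CodedRebalancing

/-! The converse bounds the two loads separately. For addition, the new node decodes from the
codewords alone, so their entropy is at least the number of bits it stores. For removal, each bit of
the removed node survives at `r - 1` nodes and must reach a survivor that lacks it. `card_lost_le`
prices such an exchange with `ρ = r - 1` holders per bit: the codeword entropy is at least `1 / ρ`
times the number of lost bits. Its proof conditions on what a set `A` of nodes stores or is to
receive, enlarges `A` by one node `k`, and sums over `k ∉ A`. The entropy inequality
`sum_residual_insert_le` and the counting identity `sum_card_lost_sdiff` carry the same factor `|Aᶜ|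
- 1`, so the induction closes without loss.

For achievability, the vector of a bit is shortened on removal and lengthened on addition. If node
`k` is removed and occurs in the vector, its entry is deleted and no bit moves. Otherwise the vector
is `(v, x)`; deleting the last entry `x` makes `x` the only new holder. The lost bits of `(v, x)`
are split evenly according to a label `y`, one of the `r - 1` other nodes outside `v`. For each `v`
and `y`, node `y` broadcasts XORs over all `x` of one bit of `(v, x)` labelled `y`. Each receiver
`x` already knows the summands of the other vectors `(v, x')`, so a single broadcast serves `r - 1`
nodes. On addition, old subfiles are refined by longer vectors whose deletion gives back the old
ones. A bit of the new node is sent uncoded by the last entry of its new vector, which stored it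
before. `uniformFibers_dropNode` keeps all subfiles equally large. -/

/-! ### Entropy of equivalence relations on a finite set -/

namespace Setoid

variable {Ω : Type*} [Fintype Ω]

open scoped Classical in
/-- The number of elements of the equivalence class of `ω`. -/
noncomputable def classCard (s : Setoid Ω) (ω : Ω) : ℕ := (Finset.univ.filter fun x => s ω x).card

/-- The Shannon entropy, in bits, of the class of a uniformly random element. A random variable on
`Ω` is represented by its kernel, and a tuple of random variables by the infimum of the kernels. -/
noncomputable def entropy (s : Setoid Ω) : ℝ :=
  (∑ ω, (Real.log (Fintype.card Ω) - Real.log (s.classCard ω))) / (Fintype.card Ω * Real.log 2)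

open scoped Classical in
theorem classCard_pos (s : Setoid Ω) (ω : Ω) : 0 < s.classCard ω :=
  Finset.card_pos.2 ⟨ω, by simp⟩

open scoped Classical in
theorem classCard_mono {s t : Setoid Ω} (h : s ≤ t) (ω : Ω) : s.classCard ω ≤ t.classCard ω :=
  Finset.card_le_card fun x hx => by
    simp only [Finset.mem_filter, Finset.mem_univ, true_and] at hx ⊢
    exact h hx

open scoped Classical in
theorem classCard_congr (s : Setoid Ω) {ω x : Ω} (h : s ω x) : s.classCard ω = s.classCard x := by
  unfold classCard
  congr 1
  ext y
  simp only [Finset.mem_filter, Finset.mem_univ, true_and]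
  exact ⟨fun h' => s.trans (s.symm h) h', fun h' => s.trans h h'⟩

theorem entropy_anti {s t : Setoid Ω} (h : s ≤ t) : t.entropy ≤ s.entropy := by
  unfold entropy
  have := Real.log_pos (one_lt_two)
  gcongr with ω
  · exact_mod_cast s.classCard_pos ω
  · exact classCard_mono h ω

open scoped Classical in
/-- The reciprocals of the class sizes add up to one over each class. -/
theorem sum_inv_classCard_filter (s : Setoid Ω) (ω : Ω) :
    ∑ x ∈ Finset.univ.filter (fun x => s ω x), (1 / (s.classCard x : ℝ)) = 1 := by
  rw [Finset.sum_congr rfl (g := fun _ => 1 / (s.classCard ω : ℝ))]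
  · rw [Finset.sum_const, nsmul_eq_mul]
    have := s.classCard_pos ω
    unfold classCard at *
    field_simp
  · intro x hx
    rw [s.classCard_congr (Finset.mem_filter.1 hx).2]

-- Double counting behind submodularity. The product of the `f`- and `g`-class sizes of `ω` counts
-- pairs `(x, y)` with `x ~ ω` under `f` and `y ~ ω` under `g`. For a fixed pair, the admissible `ω`
-- form one class of `f ⊓ g` or none, so the reciprocals of its size add up to at most 1; moreover
-- `x` and `y` are then `h`-equivalent, and the weights `1 / |h-class|` add up to `|Ω|`.
open scoped Classical in
theorem sum_classCard_mul_div_le {f g h : Setoid Ω} (hf : f ≤ h) (hg : g ≤ h) :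
    ∑ ω, (f.classCard ω * g.classCard ω : ℝ) / ((f ⊓ g).classCard ω * h.classCard ω) ≤
      Fintype.card Ω := by
  have key : ∀ x y, ∑ ω, (if f x ω ∧ g y ω then
      1 / ((f ⊓ g).classCard ω * h.classCard ω : ℝ) else 0) ≤
      if h x y then 1 / (h.classCard x : ℝ) else 0 := by
    intro x y
    by_cases hex : ∃ ω₀, f x ω₀ ∧ g y ω₀
    · obtain ⟨ω₀, h1, h2⟩ := hex
      rw [if_pos (h.trans (hf h1) (h.symm (hg h2))), ← Finset.sum_filter]
      have e : Finset.univ.filter (fun ω => f x ω ∧ g y ω) =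
          Finset.univ.filter (fun ω => (f ⊓ g) ω₀ ω) := by
        ext ω
        simp only [Finset.mem_filter, Finset.mem_univ, true_and]
        exact ⟨fun ⟨a, b⟩ => ⟨f.trans (f.symm h1) a, g.trans (g.symm h2) b⟩,
          fun ⟨a, b⟩ => ⟨f.trans h1 a, g.trans h2 b⟩⟩
      rw [e]
      rw [Finset.sum_congr rfl
        (g := fun ω => 1 / (h.classCard x : ℝ) * (1 / ((f ⊓ g).classCard ω : ℝ)))]
      · rw [← Finset.mul_sum, sum_inv_classCard_filter, mul_one]
      · intro ω hω
        rw [← e] at hω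
        simp only [Finset.mem_filter, Finset.mem_univ, true_and] at hω
        rw [h.classCard_congr (hf hω.1), one_div_mul_one_div, mul_comm]
    · push Not at hex
      rw [Finset.sum_eq_zero fun ω _ => if_neg fun hh => hex ω hh.1 hh.2]
      split_ifs <;> positivity
  calc _ = ∑ ω, ∑ x, ∑ y, (if f x ω ∧ g y ω then
      1 / ((f ⊓ g).classCard ω * h.classCard ω : ℝ) else 0) := by
        refine Finset.sum_congr rfl fun ω _ => ?_
        have hc : ∀ s : Setoid Ω, (s.classCard ω : ℝ) = ∑ x, if s x ω then 1 else 0 := by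
          intro s
          rw [classCard, Finset.card_filter]
          push_cast
          exact Finset.sum_congr rfl fun x _ => by simp only [s.comm' (x := ω)]
        rw [hc f, hc g, Finset.sum_mul_sum, Finset.sum_div]
        refine Finset.sum_congr rfl fun x _ => ?_
        rw [Finset.sum_div]
        refine Finset.sum_congr rfl fun y _ => ?_
        by_cases h1 : f x ω <;> by_cases h2 : g y ω <;> simp [h1, h2]
    _ = ∑ x, ∑ y, ∑ ω, (if f x ω ∧ g y ω then
      1 / ((f ⊓ g).classCard ω * h.classCard ω : ℝ) else 0) := by
        rw [Finset.sum_comm]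
        exact Finset.sum_congr rfl fun x _ => Finset.sum_comm
    _ ≤ ∑ x, ∑ y, if h x y then 1 / (h.classCard x : ℝ) else 0 :=
        Finset.sum_le_sum fun x _ => Finset.sum_le_sum fun y _ => key x y
    _ = ∑ x : Ω, (1 : ℝ) := by
        refine Finset.sum_congr rfl fun x _ => ?_
        rw [← Finset.sum_filter]
        refine Eq.trans (Finset.sum_congr rfl fun y hy => ?_) (sum_inv_classCard_filter h x)
        rw [h.classCard_congr (Finset.mem_filter.1 hy).2]
    _ = Fintype.card Ω := by simp

/-- Submodularity of the entropy. -/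
theorem entropy_submodular {f g h : Setoid Ω} (hf : f ≤ h) (hg : g ≤ h) :
    (f ⊓ g).entropy + h.entropy ≤ f.entropy + g.entropy := by
  have h2 := Real.log_pos (one_lt_two)
  unfold entropy
  rw [← add_div, ← add_div, ← Finset.sum_add_distrib, ← Finset.sum_add_distrib]
  gcongr ?_ / _
  rw [← sub_nonpos, ← Finset.sum_sub_distrib]
  have := sum_classCard_mul_div_le hf hg
  calc _ ≤ ∑ ω, ((f.classCard ω * g.classCard ω : ℝ) /
        ((f ⊓ g).classCard ω * h.classCard ω) - 1) := by
        refine Finset.sum_le_sum fun ω _ => ?_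
        have p1 : (0 : ℝ) < f.classCard ω := by exact_mod_cast classCard_pos f ω
        have p2 : (0 : ℝ) < g.classCard ω := by exact_mod_cast classCard_pos g ω
        have p3 : (0 : ℝ) < (f ⊓ g).classCard ω := by exact_mod_cast classCard_pos (f ⊓ g) ω
        have p4 : (0 : ℝ) < h.classCard ω := by exact_mod_cast classCard_pos h ω
        -- Jensen's inequality in tangent form: `log t ≤ t - 1`, where the average of `t` over `ω`
        -- is at most 1 by `sum_classCard_mul_div_le`.
        have := Real.log_le_sub_one_of_pos (div_pos (mul_pos p1 p2) (mul_pos p3 p4))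
        rw [Real.log_div (by positivity) (by positivity), Real.log_mul p1.ne' p2.ne',
          Real.log_mul p3.ne' p4.ne'] at this
        linarith
    _ ≤ 0 := by
        rw [Finset.sum_sub_distrib]
        simpa using this

/-- The conditional entropy of a tuple is at most the sum of the conditional entropies. -/
theorem entropy_finset_inf_le {ι : Type*} (S : Finset ι) (X : ι → Setoid Ω) (Z : Setoid Ω) :
    (S.inf X ⊓ Z).entropy - Z.entropy ≤ ∑ i ∈ S, ((X i ⊓ Z).entropy - Z.entropy) := by
  classical
  induction S using Finset.induction_on with
  | empty => simp
  | insert i S hi ih =>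
    rw [Finset.sum_insert hi, Finset.inf_insert, inf_inf_distrib_right]
    have := entropy_submodular (f := X i ⊓ Z) (g := S.inf X ⊓ Z) inf_le_right inf_le_right
    linarith

/-- The entropy of a random variable is at most the logarithm of the number of its values. -/
theorem entropy_ker_le {β : Type*} [Fintype β] [Nonempty Ω] (f : Ω → β) :
    (ker f).entropy ≤ Real.log (Fintype.card β) / Real.log 2 := by
  classical
  have h2 := Real.log_pos (one_lt_two)
  have hΩ : (0 : ℝ) < Fintype.card Ω := by exact_mod_cast Fintype.card_pos
  have hβ : (0 : ℝ) < Fintype.card β := by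
    have : Nonempty β := ⟨f (Classical.arbitrary Ω)⟩
    exact_mod_cast Fintype.card_pos
  -- The sum counts the values attained by `f`: each nonempty fibre contributes 1.
  have hs : ∑ ω, 1 / ((ker f).classCard ω : ℝ) ≤ Fintype.card β := by
    rw [← Finset.sum_fiberwise Finset.univ f]
    calc _ ≤ ∑ b : β, (1 : ℝ) := by
          refine Finset.sum_le_sum fun b _ => ?_
          by_cases hb : ∃ ω, f ω = b
          · obtain ⟨ω, rfl⟩ := hb
            refine (Eq.trans (Finset.sum_congr ?_ fun _ _ => rfl)
              (sum_inv_classCard_filter (ker f) ω)).le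
            ext x
            simp [Setoid.ker_def, eq_comm]
          · push Not at hb
            rw [Finset.filter_false_of_mem fun x _ => hb x, Finset.sum_empty]
            exact zero_le_one
      _ = Fintype.card β := by simp
  unfold entropy
  rw [div_mul_eq_div_div]
  gcongr ?_ / _
  rw [div_le_iff₀ hΩ, ← sub_nonpos, mul_comm]
  calc _ = ∑ ω, (Real.log (Fintype.card Ω) - Real.log ((ker f).classCard ω) -
        Real.log (Fintype.card β)) := by
        rw [Finset.sum_sub_distrib _ (fun _ => Real.log (Fintype.card β))]
        simp
    _ ≤ ∑ ω, (Fintype.card Ω / Fintype.card β * (1 / (ker f).classCard ω : ℝ) - 1) := by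
        refine Finset.sum_le_sum fun ω _ => ?_
        have p1 : (0 : ℝ) < (ker f).classCard ω := by exact_mod_cast classCard_pos _ ω
        have := Real.log_le_sub_one_of_pos (div_pos hΩ (mul_pos p1 hβ))
        rw [Real.log_div (by positivity) (by positivity), Real.log_mul p1.ne' hβ.ne'] at this
        have e : (Fintype.card Ω : ℝ) / Fintype.card β * (1 / (ker f).classCard ω : ℝ) =
          Fintype.card Ω / ((ker f).classCard ω * Fintype.card β) := by field_simp
        rw [e]
        linarith
    _ ≤ 0 := by
        rw [Finset.sum_sub_distrib, ← Finset.mul_sum]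
        have : (Fintype.card Ω : ℝ) / Fintype.card β * ∑ ω, 1 / ((ker f).classCard ω : ℝ) ≤
            Fintype.card Ω / Fintype.card β * Fintype.card β := by gcongr
        rw [div_mul_cancel₀ _ hβ.ne'] at this
        simpa using this

/-- The entropy of a random variable all of whose fibres have the same size. -/
theorem entropy_eq_of_classCard {s : Setoid Ω} [Nonempty Ω] {a b : ℕ}
    (h : ∀ ω, s.classCard ω = 2 ^ a) (hΩ : Fintype.card Ω = 2 ^ (a + b)) : s.entropy = b := by
  have h2 := Real.log_pos (one_lt_two)
  unfold entropy
  simp only [h, hΩ, Finset.sum_const, Finset.card_univ, nsmul_eq_mul]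
  push_cast
  rw [Real.log_pow, Real.log_pow]
  push_cast
  field_simp
  ring

end Setoid
-- Entropy bound for data exchange
namespace CodedRebalancing

/-- The kernel of the bits in the positions `F`. -/
def agree {N : ℕ} (F : Finset (Fin N)) : Setoid (File N) := Setoid.ker fun W (n : F) => W n

variable {N : ℕ}

theorem agree_iff {F : Finset (Fin N)} {W W' : File N} :
    agree F W W' ↔ ∀ n ∈ F, W n = W' n := by
  rw [agree, Setoid.ker_def, funext_iff]
  exact Subtype.forall

theorem agree_union (F G : Finset (Fin N)) : agree (F ∪ G) = agree F ⊓ agree G := by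
  ext W W'
  simp only [Setoid.inf_iff_and, agree_iff, Finset.mem_union, or_imp, forall_and]

theorem agree_anti {F G : Finset (Fin N)} (h : F ⊆ G) : agree G ≤ agree F := fun _ _ hw =>
  agree_iff.2 fun n hn => agree_iff.1 hw n (h hn)

theorem entropy_agree (F : Finset (Fin N)) : (agree F).entropy = F.card := by
  classical
  have hF : F.card ≤ N := by simpa using F.card_le_univ
  refine Setoid.entropy_eq_of_classCard (a := N - F.card) (fun W => ?_) ?_
  · have : (Finset.univ.filter fun W' => agree F W W') =
        Fintype.piFinset fun n => if n ∈ F then {W n} else Finset.univ := by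
      ext W'
      simp only [Finset.mem_filter, Finset.mem_univ, true_and, agree_iff, Fintype.mem_piFinset]
      refine forall_congr' fun n => ?_
      by_cases hn : n ∈ F <;> simp [hn, eq_comm]
    rw [Setoid.classCard]
    convert congrArg Finset.card this using 1
    rw [Fintype.card_piFinset]
    simp only [apply_ite Finset.card, Finset.card_singleton, Finset.prod_ite, Finset.prod_const_one,
      one_mul, Finset.prod_const, Finset.card_univ, ZMod.card]
    congr 1
    rw [← Finset.compl_filter]
    simp [Finset.card_compl]
  · simp [ZMod.card, Nat.sub_add_cancel hF]

section Exchange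

variable {ι : Type*} [DecidableEq ι]

/-- The bits that the nodes of `A` store, or demand as the designated receivers `d`. -/
def known (C : ι → Finset (Fin N)) (lost : Finset (Fin N)) (d : Fin N → ι) (A : Finset ι) :
    Finset (Fin N) :=
  A.biUnion fun i => C i ∪ lost.filter fun n => d n = i

variable {C : ι → Finset (Fin N)} {lost : Finset (Fin N)} {d : Fin N → ι}
  {X : ι → Setoid (File N)}

theorem mem_known {A : Finset ι} {n : Fin N} :
    n ∈ known C lost d A ↔ ∃ i ∈ A, n ∈ C i ∨ n ∈ lost ∧ d n = i := by
  simp [known]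

theorem known_insert (k : ι) (A : Finset ι) :
    known C lost d (insert k A) =
      known C lost d A ∪ C k ∪ lost.filter fun n => d n = k := by
  simp only [known, Finset.biUnion_insert]
  rw [Finset.union_comm, Finset.union_assoc]

variable [Fintype ι]

/-- The entropy of the codewords, given the bits known to the nodes of `A`. -/
noncomputable def residual (C : ι → Finset (Fin N)) (lost : Finset (Fin N)) (d : Fin N → ι)
    (X : ι → Setoid (File N)) (A : Finset ι) : ℝ :=
  (Finset.univ.inf X ⊓ agree (known C lost d A)).entropy - (known C lost d A).card

theorem residual_nonneg (A : Finset ι) : 0 ≤ residual C lost d X A := by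
  have := Setoid.entropy_anti
    (inf_le_right : Finset.univ.inf X ⊓ agree (known C lost d A) ≤ agree (known C lost d A))
  rw [entropy_agree] at this
  exact sub_nonneg.2 this

/-- With `Y` the bits known to `A`, submodularity bounds the entropy of all codewords given `Y` and
`C k` by `H(X | Y) - H(X_k | Y)`, since `X_k` is a function of `C k`. The former entropy splits into
the new bits delivered to `k`, which are decodable, and the residual of `insert k A`. Summing over
`k ∉ A`, subadditivity of the `H(X_k | Y)` saves one whole `H(X | Y)`. -/
theorem sum_residual_insert_le (hX : ∀ i, agree (C i) ≤ X i)
    (hdec : ∀ n ∈ lost, Finset.univ.inf X ⊓ agree (C (d n)) ≤ agree {n})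
    (hdC : ∀ n ∈ lost, n ∉ C (d n)) (A : Finset ι) :
    ∑ k ∈ Aᶜ, (residual C lost d X (insert k A) +
      ((lost.filter fun n => d n = k) \ known C lost d A).card) ≤
      ((Aᶜ.card : ℝ) - 1) * residual C lost d X A := by
  set Y := known C lost d A with hY
  have h1 : ∀ k, residual C lost d X (insert k A) +
      ((lost.filter fun n => d n = k) \ Y).card ≤
      residual C lost d X A - ((X k ⊓ agree Y).entropy - (agree Y).entropy) := by
    intro k
    have hs := Setoid.entropy_submodular (f := Finset.univ.inf X ⊓ agree Y)
      (g := agree (Y ∪ C k)) (h := X k ⊓ agree Y)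
      (inf_le_inf_right _ (Finset.inf_le (Finset.mem_univ k)))
      (by rw [agree_union, inf_comm]; exact inf_le_inf_right _ (hX k))
    -- The bits demanded by `k` are determined by the codewords and `C k`, so including them does
    -- not refine the kernel.
    have e : Finset.univ.inf X ⊓ agree (known C lost d (insert k A)) =
        (Finset.univ.inf X ⊓ agree Y) ⊓ agree (Y ∪ C k) := by
      rw [known_insert]
      apply le_antisymm
      · refine le_inf (inf_le_inf_left _ (agree_anti ?_)) (inf_le_of_right_le (agree_anti ?_))
        · exact Finset.subset_union_left.trans Finset.subset_union_left
        · exact Finset.subset_union_left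
      · refine le_inf (inf_le_of_left_le inf_le_left) ?_
        rw [agree_union (Y ∪ C k)]
        refine le_inf inf_le_right ?_
        intro W W' hW
        refine agree_iff.2 fun n hn => ?_
        obtain ⟨hl, rfl⟩ := Finset.mem_filter.1 hn
        have hle : (Finset.univ.inf X ⊓ agree Y) ⊓ agree (Y ∪ C (d n)) ≤ agree {n} :=
          le_trans (inf_le_inf inf_le_left (agree_anti Finset.subset_union_right)) (hdec n hl)
        exact agree_iff.1 (hle hW) n (Finset.mem_singleton_self n)
    have ec : (known C lost d (insert k A)).card =
        (Y ∪ C k).card + ((lost.filter fun n => d n = k) \ Y).card := by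
      rw [known_insert, ← Finset.card_union_of_disjoint]
      · congr 1
        ext n
        simp only [Finset.mem_union, Finset.mem_sdiff, ← hY]
        tauto
      · rw [Finset.disjoint_left]
        intro n hn hn'
        simp only [Finset.mem_sdiff, Finset.mem_filter] at hn'
        obtain ⟨⟨hl, rfl⟩, hnY⟩ := hn'
        exact (Finset.mem_union.1 hn).elim hnY (hdC n hl)
    rw [entropy_agree] at hs ⊢
    unfold residual
    rw [e, ec]
    push_cast
    linarith
  -- Given `Y`, the codewords of the nodes of `A` are constant; only those of `Aᶜ` matter.
  have h2 : Aᶜ.inf X ⊓ agree Y = Finset.univ.inf X ⊓ agree Y := by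
    apply le_antisymm
    · refine le_inf (Finset.le_inf fun i _ => ?_) inf_le_right
      by_cases hi : i ∈ A
      · refine inf_le_of_right_le (le_trans (agree_anti fun n hn => ?_) (hX i))
        exact mem_known.2 ⟨i, hi, Or.inl hn⟩
      · exact inf_le_of_left_le (Finset.inf_le (Finset.mem_compl.2 hi))
    · exact inf_le_inf_right _ (Finset.inf_mono (Finset.subset_univ _))
  have h3 := Setoid.entropy_finset_inf_le Aᶜ X (agree Y)
  rw [h2] at h3
  refine (Finset.sum_le_sum fun k _ => h1 k).trans ?_
  rw [Finset.sum_sub_distrib, Finset.sum_const, nsmul_eq_mul]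
  have : residual C lost d X A =
    (Finset.univ.inf X ⊓ agree Y).entropy - (agree Y).entropy := by rw [entropy_agree]; rfl
  linarith

/-- A lost bit unknown to `A` has its `ρ` holders and its receiver all outside `A`. It stays unknown
for `|Aᶜ| - ρ - 1` choices of `k` and is delivered, with weight `ρ`, for one choice: in total `|Aᶜ|
- 1`. -/
theorem sum_card_lost_sdiff {ρ : ℕ} (hdC : ∀ n ∈ lost, n ∉ C (d n))
    (hρ : ∀ n ∈ lost, (Finset.univ.filter fun i => n ∈ C i).card = ρ) (A : Finset ι) :
    ∑ k ∈ Aᶜ, (((lost \ known C lost d (insert k A)).card : ℝ) +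
      ρ * ((lost.filter fun n => d n = k) \ known C lost d A).card) =
      ((Aᶜ.card : ℝ) - 1) * (lost \ known C lost d A).card := by
  set Y := known C lost d A with hY
  have h1 : ∀ k, ((lost \ known C lost d (insert k A)).card : ℝ) =
      ∑ n ∈ lost \ Y, (1 - (if n ∈ C k then 1 else 0) - (if d n = k then 1 else 0)) := by
    intro k
    have : lost \ known C lost d (insert k A) =
        (lost \ Y).filter fun n => n ∉ C k ∧ d n ≠ k := by
      ext n
      simp only [known_insert, Finset.mem_sdiff, Finset.mem_union, Finset.mem_filter, ← hY]
      tauto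
    rw [this, Finset.card_filter]
    push_cast
    refine Finset.sum_congr rfl fun n hn => ?_
    have := hdC n (Finset.mem_sdiff.1 hn).1
    by_cases h : d n = k
    · rw [h] at this
      simp [h, this]
    · by_cases h' : n ∈ C k <;> simp [h, h']
  have h2 : ∀ k, (((lost.filter fun n => d n = k) \ Y).card : ℝ) =
      ∑ n ∈ lost \ Y, (if d n = k then 1 else 0) := by
    intro k
    have : (lost.filter fun n => d n = k) \ Y = (lost \ Y).filter fun n => d n = k := by
      ext n
      simp only [Finset.mem_sdiff, Finset.mem_filter]
      tauto
    rw [this, Finset.card_filter]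
    push_cast
    rfl
  simp only [h1, h2, Finset.mul_sum, ← Finset.sum_add_distrib]
  rw [Finset.sum_comm, Finset.sum_congr rfl (g := fun _ => (Aᶜ.card : ℝ) - 1)]
  · rw [Finset.sum_const, nsmul_eq_mul, mul_comm]
  intro n hn
  obtain ⟨hl, hnY⟩ := Finset.mem_sdiff.1 hn
  have hd : d n ∈ Aᶜ := Finset.mem_compl.2 fun h => hnY (mem_known.2 ⟨_, h, Or.inr ⟨hl, rfl⟩⟩)
  have hc : ∑ k ∈ Aᶜ, (if n ∈ C k then (1 : ℝ) else 0) = ρ := by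
    rw [← hρ n hl, Finset.card_filter]
    push_cast
    refine Finset.sum_subset (Finset.subset_univ _) fun i _ hi => if_neg fun h => ?_
    rw [Finset.mem_compl, not_not] at hi
    exact hnY (mem_known.2 ⟨i, hi, Or.inl h⟩)
  have hd' : ∑ k ∈ Aᶜ, (if d n = k then (1 : ℝ) else 0) = 1 := by
    rw [Finset.sum_ite_eq, if_pos hd]
  rw [Finset.sum_add_distrib, Finset.sum_sub_distrib, Finset.sum_sub_distrib, ← Finset.mul_sum,
    hc, hd']
  simp only [Finset.sum_const, nsmul_eq_mul, mul_one]
  ring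

/-- Induction on `|Aᶜ|`: the two sums over `k ∉ A` are compared term by term, and the common factor
`|Aᶜ| - 1` is cancelled. -/
theorem card_lost_sdiff_le {ρ : ℕ} (hρ0 : 0 < ρ) (hX : ∀ i, agree (C i) ≤ X i)
    (hdec : ∀ n ∈ lost, Finset.univ.inf X ⊓ agree (C (d n)) ≤ agree {n})
    (hdC : ∀ n ∈ lost, n ∉ C (d n))
    (hρ : ∀ n ∈ lost, (Finset.univ.filter fun i => n ∈ C i).card = ρ) (A : Finset ι) :
    ((lost \ known C lost d A).card : ℝ) ≤ ρ * residual C lost d X A := by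
  induction hs : Aᶜ.card using Nat.strong_induction_on generalizing A with
  | _ s ih =>
  rcases Finset.eq_empty_or_nonempty (lost \ known C lost d A) with h0 | ⟨n, hn⟩
  · rw [h0, Finset.card_empty, Nat.cast_zero]
    exact mul_nonneg (Nat.cast_nonneg _) (residual_nonneg A)
  -- The receiver of an unknown bit and one of its holders are two different nodes of `Aᶜ`, so the
  -- factor to cancel is positive.
  have h1 : 1 < Aᶜ.card := by
    obtain ⟨hl, hnY⟩ := Finset.mem_sdiff.1 hn
    obtain ⟨i, hi⟩ := Finset.card_pos.1 (hρ0.trans_eq (hρ n hl).symm)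
    have hi := (Finset.mem_filter.1 hi).2
    refine Finset.one_lt_card.2 ⟨d n, ?_, i, ?_, ?_⟩
    · exact Finset.mem_compl.2 fun h => hnY (mem_known.2 ⟨_, h, Or.inr ⟨hl, rfl⟩⟩)
    · exact Finset.mem_compl.2 fun h => hnY (mem_known.2 ⟨_, h, Or.inl hi⟩)
    · rintro rfl
      exact hdC n hl hi
  have h1' : (0 : ℝ) < (Aᶜ.card : ℝ) - 1 := by
    have : (1 : ℝ) < Aᶜ.card := by exact_mod_cast h1
    linarith
  refine le_of_mul_le_mul_left ?_ h1'
  rw [← sum_card_lost_sdiff hdC hρ A]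
  calc _ ≤ ∑ k ∈ Aᶜ, ρ * (residual C lost d X (insert k A) +
        ((lost.filter fun n => d n = k) \ known C lost d A).card) := by
        refine Finset.sum_le_sum fun k hk => ?_
        have hlt : (insert k A)ᶜ.card < s := by
          rw [← hs]
          refine Finset.card_lt_card (Finset.ssubset_iff_of_subset ?_ |>.2 ⟨k, hk, by simp⟩)
          exact Finset.compl_subset_compl.2 (Finset.subset_insert k A)
        have := ih _ hlt (insert k A) rfl
        rw [mul_add]
        linarith
    _ ≤ _ := by
        rw [← Finset.mul_sum]
        have := mul_le_mul_of_nonneg_left (sum_residual_insert_le hX hdec hdC A)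
          (Nat.cast_nonneg (α := ℝ) ρ)
        linarith

/-- The cost of a data exchange: if each lost bit is stored at `ρ` nodes and is to be delivered to
another one, then the codewords have entropy at least `1 / ρ` times the number of lost bits. -/
theorem card_lost_le {ρ : ℕ} (hρ0 : 0 < ρ) (hX : ∀ i, agree (C i) ≤ X i)
    (hdec : ∀ n ∈ lost, Finset.univ.inf X ⊓ agree (C (d n)) ≤ agree {n})
    (hdC : ∀ n ∈ lost, n ∉ C (d n))
    (hρ : ∀ n ∈ lost, (Finset.univ.filter fun i => n ∈ C i).card = ρ) :
    (lost.card : ℝ) ≤ ρ * (Finset.univ.inf X).entropy := by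
  have h := card_lost_sdiff_le hρ0 hX hdec hdC hρ ∅
  have h0 : known C lost d ∅ = ∅ := rfl
  have h1 : residual C lost d X ∅ ≤ (Finset.univ.inf X).entropy := by
    unfold residual
    rw [h0]
    have : agree (∅ : Finset (Fin N)) = ⊤ := Setoid.eq_top_iff.2 fun _ _ => agree_iff.2 (by simp)
    rw [this]
    simp
  rw [h0, Finset.sdiff_empty] at h
  exact h.trans (mul_le_mul_of_nonneg_left h1 (Nat.cast_nonneg _))

end Exchange

/-! ### Converse bounds on the loads -/

theorem Database.IsBalanced.sum_card_store {V : Type} [Fintype V] {r : ℕ} {C : Database V N}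
    (h : C.IsBalanced r) : ∑ i, (C.store i).card = r * N := by
  classical
  have : ∀ i, (C.store i).card = ∑ n, if n ∈ C.store i then 1 else 0 := by simp
  rw [Finset.sum_congr rfl fun i _ => this i, Finset.sum_comm,
    Finset.sum_congr rfl (g := fun _ => r)]
  · simp [mul_comm]
  · intro n _
    rw [← Finset.card_filter]
    rw [← h.replication_eq n, Database.replication]

theorem Database.IsBalanced.card_store_mul {V : Type} [Fintype V] {r : ℕ} {C : Database V N}
    (h : C.IsBalanced r) (i : V) : Fintype.card V * (C.store i).card = r * N := by
  rw [← h.sum_card_store, Finset.sum_congr rfl fun j _ => h.card_store_eq j i]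
  simp

theorem Database.IsBalanced.card_store_pos {V : Type} [Fintype V] {r : ℕ} {C : Database V N}
    (h : C.IsBalanced r) (hr : 0 < r) (hN : 0 < N) (i : V) : 0 < (C.store i).card := by
  have := h.card_store_mul i
  exact Nat.pos_of_mul_pos_left (this ▸ Nat.mul_pos hr hN)

theorem log_card_codewords {ι : Type*} [Fintype ι] [DecidableEq ι] (len : ι → ℕ) :
    Real.log (Fintype.card (∀ i, Fin (len i) → Bit)) / Real.log 2 = ∑ i, (len i : ℝ) := by
  have h2 := Real.log_pos (one_lt_two)
  have : Fintype.card (∀ i, Fin (len i) → Bit) = 2 ^ ∑ i, len i := by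
    simp [Fintype.card_pi, ZMod.card, Finset.prod_pow_eq_pow_sum]
  rw [this]
  push_cast
  rw [Real.log_pow]
  push_cast
  field_simp

theorem RemovalScheme.le_load {r K : ℕ} (hr : 2 ≤ r) (hN : 0 < N) {C : Database (Fin K) N}
    {k : Fin K} {T : Database {i : Fin K // i ≠ k} N} (hC : C.IsBalanced r) (hT : T.IsBalanced r)
    (R : RemovalScheme C k T) : 1 / ((r : ℝ) - 1) ≤ R.load := by
  classical
  have hpos := hC.card_store_pos (by omega) hN k
  have hsurv : ∀ n ∈ C.store k,
      (Finset.univ.filter fun i : {i : Fin K // i ≠ k} => n ∈ C.store i.1).card = r - 1 := by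
    intro n hn
    have h1 := hC.replication_eq n
    rw [Database.replication] at h1
    have h2 : (Finset.univ.filter fun i : {i : Fin K // i ≠ k} => n ∈ C.store i.1).card =
        ((Finset.univ.filter fun i => n ∈ C.store i).erase k).card := by
      rw [← Finset.card_map (Function.Embedding.subtype _)]
      congr 1
      ext i
      simp [and_comm]
    rw [h2, Finset.card_erase_of_mem (by simpa using hn), h1]
  -- The target needs `r` holders of a lost bit and only `r - 1` survivors have it, so some survivor
  -- is a genuine receiver.
  have hd : ∀ n, ∃ i : {i : Fin K // i ≠ k},
      n ∈ C.store k → n ∈ T.store i ∧ n ∉ C.store i.1 := by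
    intro n
    -- `i₀` is only a default receiver for bits outside `C.store k`.
    obtain ⟨i₀, -⟩ := T.cover n
    by_cases hn : n ∈ C.store k
    · by_contra! hcon
      have h1 := hT.replication_eq n
      have h2 := hsurv n hn
      have : Finset.univ.filter (fun i => n ∈ T.store i) ⊆
          Finset.univ.filter fun i : {i : Fin K // i ≠ k} => n ∈ C.store i.1 := by
        intro i hi
        simp only [Finset.mem_filter, Finset.mem_univ, true_and] at hi ⊢
        exact (hcon i).2 hi
      have := Finset.card_le_card this
      rw [Database.replication] at h1
      have e : (Finset.univ.filter fun i => n ∈ T.store i).card = r := by convert h1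
      omega
    · exact ⟨i₀, fun h => absurd h hn⟩
  choose d hd using hd
  let enc : ∀ i : {i : Fin K // i ≠ k}, File N → (Fin (R.len i) → Bit) := fun i W =>
    R.encode i (C.read i.1 W)
  have key := card_lost_le (C := fun i : {i : Fin K // i ≠ k} => C.store i.1)
    (lost := C.store k) (d := d) (X := fun i => Setoid.ker (enc i)) (ρ := r - 1) (by omega)
    (fun i W W' hW => by
      have : C.read i.1 W = C.read i.1 W' := hW
      simp [Setoid.ker_def, enc, this])
    (fun n hn W W' hW => by
      rw [Setoid.inf_iff_and] at hW
      obtain ⟨hX, hC'⟩ := hW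
      have h1 : C.read (d n).1 W = C.read (d n).1 W' := hC'
      have h2 : ∀ j, enc j W = enc j W' := fun j =>
        (Finset.inf_le (f := fun i => Setoid.ker (enc i)) (Finset.mem_univ j)) hX
      have h3 := R.decode_correct (d n) W
      have h4 := R.decode_correct (d n) W'
      have h5 : (fun j : {j : {i : Fin K // i ≠ k} // j ≠ d n} => R.encode j.1 (C.read j.1.1 W)) =
        fun j : {j : {i : Fin K // i ≠ k} // j ≠ d n} => R.encode j.1 (C.read j.1.1 W') := funext fun j => h2 j.1
      rw [h1, h5, h4] at h3
      refine agree_iff.2 fun m hm => ?_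
      rw [Finset.mem_singleton.1 hm]
      exact (congrFun h3 ⟨n, (hd n hn).1⟩).symm)
    (fun n hn => (hd n hn).2) hsurv
  have hH : (Finset.univ.inf fun i => Setoid.ker (enc i)).entropy ≤ ∑ i, (R.len i : ℝ) := by
    rw [← log_card_codewords]
    refine le_trans (Setoid.entropy_anti ?_) (Setoid.entropy_ker_le fun W i => enc i W)
    refine Finset.le_inf fun i _ W W' hW => ?_
    exact congrFun (Setoid.ker_def.1 hW) i
  have hr' : ((r - 1 : ℕ) : ℝ) = (r : ℝ) - 1 := by rw [Nat.cast_sub (by omega)]; simp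
  have hr0 : (0 : ℝ) < (r : ℝ) - 1 := by
    have : (2 : ℝ) ≤ r := by exact_mod_cast hr
    linarith
  rw [hr'] at key
  have hpos' : (0 : ℝ) < (C.store k).card := by exact_mod_cast hpos
  rw [RemovalScheme.load, div_le_div_iff₀ hr0 hpos', one_mul, mul_comm]
  exact key.trans (mul_le_mul_of_nonneg_left hH hr0.le)

theorem AdditionScheme.one_le_load {r K : ℕ} (hr : 2 ≤ r) (hN : 0 < N) {C : Database (Fin K) N}
    {T : Database (Fin (K + 1)) N} (hT : T.IsBalanced r) (R : AdditionScheme C T) :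
    1 ≤ R.load := by
  have hpos : (0 : ℝ) < (T.store (Fin.last K)).card := by
    exact_mod_cast hT.card_store_pos (by omega) hN _
  rw [AdditionScheme.load, one_le_div hpos, ← log_card_codewords, ← entropy_agree]
  refine le_trans (Setoid.entropy_anti ?_)
    (Setoid.entropy_ker_le fun W i => R.encode i (C.read i W))
  intro W W' hW
  have h1 := R.decodeNew_correct W
  have h2 := R.decodeNew_correct W'
  rw [Setoid.ker_def.1 hW, h2] at h1
  exact h1.symm

theorem Design.le_load {r K : ℕ} (hr : 2 ≤ r) (hK : 0 < K) (hN : 0 < N) (D : Design r K N) :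
    1 / ((r : ℝ) - 1) + 1 ≤ D.load := by
  refine add_le_add ?_ (D.addition.one_le_load hr hN D.afterAddition_balanced)
  exact ((D.removal ⟨0, hK⟩).le_load hr hN D.initial_balanced (D.afterRemoval_balanced _)).trans
    (le_ciSup (f := fun k => (D.removal k).load) (Set.finite_range _).bddAbove ⟨0, hK⟩)

end CodedRebalancing

/-! ### Maps with fibres of equal size -/

/-- All fibres of `f` have `c` elements. -/
def UniformFibers {A B : Type*} (f : A → B) (c : ℕ) : Prop := ∀ b, {a | f a = b}.ncard = c

namespace UniformFibers

variable {A B D : Type*}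

theorem exists_equiv [Finite A] {f : A → B} {c : ℕ} (h : UniformFibers f c) :
    ∃ e : A ≃ B × Fin c, ∀ a, (e a).1 = f a := by
  have h' : ∀ b, Nonempty ({a // f a = b} ≃ Fin c) := fun b => by
    exact ⟨Finite.equivFinOfCardEq (h b)⟩
  exact ⟨(Equiv.sigmaFiberEquiv f).symm.trans ((Equiv.sigmaCongrRight fun b => (h' b).some).trans
    (Equiv.sigmaEquivProd B (Fin c))), fun a => rfl⟩

theorem of_equiv {f : A → B} {c : ℕ} (e : A ≃ B × Fin c) (he : ∀ a, (e a).1 = f a) :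
    UniformFibers f c := by
  intro b
  have : {a | f a = b} = (fun t => e.symm (b, t)) '' Set.univ := by
    ext a
    simp only [Set.mem_ofPred_eq, Set.image_univ, Set.mem_range, ← he]
    constructor
    · rintro rfl
      exact ⟨(e a).2, by simp⟩
    · rintro ⟨t, rfl⟩
      simp
  rw [this, Set.ncard_image_of_injective, Set.ncard_univ, Nat.card_eq_fintype_card,
    Fintype.card_fin]
  intro t t' h
  simpa using h

theorem card_eq [Finite A] {f : A → B} {c : ℕ} (h : UniformFibers f c) :
    Nat.card A = Nat.card B * c := by
  obtain ⟨e, -⟩ := h.exists_equiv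
  rw [Nat.card_congr e, Nat.card_prod, Nat.card_eq_fintype_card (α := Fin c), Fintype.card_fin]

theorem comp [Finite A] [Finite B] {f : A → B} {g : B → D} {c d : ℕ} (hg : UniformFibers g d)
    (hf : UniformFibers f c) : UniformFibers (g ∘ f) (d * c) := by
  obtain ⟨e, he⟩ := hf.exists_equiv
  obtain ⟨e', he'⟩ := hg.exists_equiv
  exact of_equiv (e.trans ((Equiv.prodCongrLeft fun _ => e').trans ((Equiv.prodAssoc _ _ _).trans
    (Equiv.prodCongrRight fun _ => finProdFinEquiv)))) fun a => by
      simp [he, he']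

/-- A map with fibres of size `c * q` factors through any map with fibres of size `c`. -/
theorem exists_lift [Finite A] [Finite D] {f : A → B} {g : D → B} {c q : ℕ}
    (hf : UniformFibers f (c * q)) (hg : UniformFibers g c) :
    ∃ e : A ≃ D × Fin q, ∀ a, g (e a).1 = f a := by
  obtain ⟨e, he⟩ := hf.exists_equiv
  obtain ⟨e', he'⟩ := hg.exists_equiv
  refine ⟨e.trans (((Equiv.prodCongrRight fun _ => finProdFinEquiv.symm).trans
    (Equiv.prodAssoc _ _ _).symm).trans (Equiv.prodCongrLeft fun _ => e'.symm)), fun a => ?_⟩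
  rw [← he' , ← he]
  simp

theorem of_ncard_eq {f : A → B} [Nonempty B]
    (h : ∀ v w, {a | f a = v}.ncard = {a | f a = w}.ncard) : ∃ c, UniformFibers f c :=
  ⟨_, fun b => h b (Classical.arbitrary B)⟩

theorem comp_equiv {f : A → B} {c : ℕ} (hf : UniformFibers f c) (e : D ≃ A) :
    UniformFibers (f ∘ e) c := by
  intro b
  rw [← hf b]
  exact Set.ncard_congr (fun d _ => e d) (fun d hd => hd) (fun _ _ _ _ h => e.injective h)
    fun a ha => ⟨e.symm a, by simpa using ha, by simp⟩

end UniformFibers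

/-! ### Deleting and appending entries of vectors of distinct nodes -/

section Vectors

variable {α V : Type*} {m : ℕ}

open scoped Classical in
/-- The position of `k` in the vector `u`, or the last position if `k` does not occur in `u`. -/
noncomputable def dropPos (k : α) (u : Fin (m + 1) ↪ α) : Fin (m + 1) :=
  if h : ∃ p, u p = k then h.choose else Fin.last m

theorem apply_dropPos {k : α} {u : Fin (m + 1) ↪ α} (h : k ∈ Set.range u) :
    u (dropPos k u) = k := by
  rw [dropPos, dif_pos (Set.mem_range.1 h)]
  exact (Set.mem_range.1 h).choose_spec

theorem dropPos_of_notMem {k : α} {u : Fin (m + 1) ↪ α} (h : k ∉ Set.range u) :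
    dropPos k u = Fin.last m := dif_neg h

theorem exists_drop {k : α} {ι : V ↪ α} (hι : ∀ a, a ∈ Set.range ι ↔ a ≠ k)
    (u : Fin (m + 1) ↪ α) :
    ∃ v : Fin m ↪ V, ∀ j, ι (v j) = u ((dropPos k u).succAbove j) := by
  have h : ∀ j, ∃ x, ι x = u ((dropPos k u).succAbove j) := fun j => (hι _).2 fun hk => by
    have := apply_dropPos (Set.mem_range.2 ⟨_, hk⟩)
    exact Fin.ne_succAbove _ _ (u.injective (this.trans hk.symm))
  choose v hv using h
  refine ⟨⟨v, fun j j' hj => ?_⟩, hv⟩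
  have : ι (v j) = ι (v j') := congrArg ι hj
  rw [hv, hv] at this
  exact Fin.succAbove_right_injective (u.injective this)

/-- The vector of the remaining nodes obtained by deleting the entry `k`, or else the last entry. -/
noncomputable def dropNode {k : α} {ι : V ↪ α} (hι : ∀ a, a ∈ Set.range ι ↔ a ≠ k)
    (u : Fin (m + 1) ↪ α) : Fin m ↪ V := (exists_drop hι u).choose

variable {k : α} {ι : V ↪ α} (hι : ∀ a, a ∈ Set.range ι ↔ a ≠ k)

theorem dropNode_apply (u : Fin (m + 1) ↪ α) (j : Fin m) :
    ι (dropNode hι u j) = u ((dropPos k u).succAbove j) := (exists_drop hι u).choose_spec j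

theorem mem_range_dropNode {u : Fin (m + 1) ↪ α} {x : V} :
    x ∈ Set.range (dropNode hι u) ↔ ι x ∈ Set.range u ∧ ι x ≠ u (dropPos k u) := by
  constructor
  · rintro ⟨j, rfl⟩
    rw [dropNode_apply]
    exact ⟨⟨_, rfl⟩, fun h => Fin.succAbove_ne _ _ (u.injective h)⟩
  · rintro ⟨⟨p, hp⟩, hne⟩
    obtain ⟨j, rfl⟩ := Fin.exists_succAbove_eq (x := p) (y := dropPos k u)
      (fun h => hne (by rw [← hp, h]))
    exact ⟨j, ι.injective (by rw [dropNode_apply, hp])⟩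

theorem mem_range_dropNode_of_mem {u : Fin (m + 1) ↪ α} (hu : k ∈ Set.range u) {x : V} :
    x ∈ Set.range (dropNode hι u) ↔ ι x ∈ Set.range u := by
  rw [mem_range_dropNode, apply_dropPos hu]
  exact and_iff_left ((hι _).1 ⟨x, rfl⟩)

theorem mem_range_dropNode_of_notMem {u : Fin (m + 1) ↪ α} (hu : k ∉ Set.range u) {x : V} :
    x ∈ Set.range (dropNode hι u) ↔ ι x ∈ Set.range u ∧ ι x ≠ u (Fin.last m) := by
  rw [mem_range_dropNode, dropPos_of_notMem hu]

/-- Deletion is equivariant under relabelling because `h` forces `τ` to fix `k`. This symmetry is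
what makes the deletion fibres equinumerous. -/
theorem dropNode_trans {σ : Equiv.Perm V} {τ : Equiv.Perm α} (h : ∀ x, τ (ι x) = ι (σ x))
    (u : Fin (m + 1) ↪ α) :
    dropNode hι (u.trans τ.toEmbedding) = (dropNode hι u).trans σ.toEmbedding := by
  have hk : τ k = k := by
    by_contra hne
    obtain ⟨x, hx⟩ := (hι _).2 hne
    obtain ⟨y, rfl⟩ := σ.surjective x
    rw [← h] at hx
    exact (hι k).1 ⟨y, τ.injective hx⟩ rfl
  have hpos : dropPos k (u.trans τ.toEmbedding) = dropPos k u := by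
    by_cases hu : k ∈ Set.range u
    · obtain ⟨p, hp⟩ := hu
      have h1 := apply_dropPos (k := k) (u := u.trans τ.toEmbedding) ⟨p, by simp [hp, hk]⟩
      have h2 : u (dropPos k (u.trans τ.toEmbedding)) = k := τ.injective (h1.trans hk.symm)
      exact u.injective (h2.trans (apply_dropPos ⟨p, hp⟩).symm)
    · rw [dropPos_of_notMem hu, dropPos_of_notMem]
      rintro ⟨p, hp⟩
      exact hu ⟨p, τ.injective (hp.trans hk.symm)⟩
  ext j
  apply ι.injective
  rw [dropNode_apply, hpos]
  simp [← h, dropNode_apply]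

/-- Permutations of `V` act transitively on the shorter vectors, so all fibres have one size, which
the total count determines. Directly: `k` can be inserted at `m + 1` places, or one of `|V| - m`
other nodes appended. -/
theorem uniformFibers_dropNode [Fintype α] [Fintype V] (hm : m ≤ Fintype.card V) :
    UniformFibers (dropNode hι : (Fin (m + 1) ↪ α) → (Fin m ↪ V)) (Fintype.card V + 1) := by
  classical
  have hne : Nonempty (Fin m ↪ V) := Function.Embedding.nonempty_of_card_le (by simpa using hm)
  obtain ⟨c, hc⟩ := UniformFibers.of_ncard_eq
    (f := (dropNode hι : (Fin (m + 1) ↪ α) → (Fin m ↪ V))) fun v w => by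
      obtain ⟨σ, hσ⟩ := Equiv.Perm.exists_extending_pair v w v.injective w.injective
      have h : ∀ x, σ.viaEmbedding ι (ι x) = ι (σ x) := Equiv.Perm.viaEmbedding_apply σ ι
      have hvw : v.trans σ.toEmbedding = w := by
        ext j
        simp [hσ]
      refine Set.ncard_congr (fun u _ => u.trans (σ.viaEmbedding ι).toEmbedding) ?_ ?_ ?_
      · intro u hu
        simp only [Set.mem_ofPred_eq] at hu ⊢
        rw [dropNode_trans hι h, hu, hvw]
      · intro u u' _ _ huu
        ext j
        simpa using DFunLike.congr_fun huu j
      · intro u hu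
        have e : (u.trans (σ.viaEmbedding ι).symm.toEmbedding).trans
            (σ.viaEmbedding ι).toEmbedding = u := by
          ext j
          simp
        refine ⟨u.trans (σ.viaEmbedding ι).symm.toEmbedding, ?_, e⟩
        simp only [Set.mem_ofPred_eq] at hu ⊢
        rw [← e, dropNode_trans hι h, ← hvw] at hu
        ext j
        simpa using DFunLike.congr_fun hu j
  have hα : Fintype.card α = Fintype.card V + 1 := by
    have : Finset.univ.map ι = Finset.univ.erase k := by
      ext a
      simpa using hι a
    have := congrArg Finset.card this
    rw [Finset.card_map, Finset.card_erase_of_mem (Finset.mem_univ _), Finset.card_univ,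
      Finset.card_univ] at this
    have := Fintype.card_pos_iff.2 ⟨k⟩
    omega
  have := hc.card_eq
  rw [Nat.card_eq_fintype_card, Nat.card_eq_fintype_card, Fintype.card_embedding_eq,
    Fintype.card_embedding_eq, hα, Fintype.card_fin, Fintype.card_fin,
    Nat.succ_descFactorial_succ, mul_comm] at this
  have h0 : 0 < (Fintype.card V).descFactorial m := Nat.descFactorial_pos.2 hm
  rwa [Nat.eq_of_mul_eq_mul_left h0 this]

/-- The vector `v`, followed by the entry `x`. -/
def appendNode (ι : V ↪ α) (v : Fin m ↪ V) (x : V) (hx : x ∉ Set.range v) : Fin (m + 1) ↪ α :=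
  Fin.Embedding.snoc (v.trans ι) (a := ι x) (by simpa using hx)

theorem appendNode_last {v : Fin m ↪ V} {x : V} (hx : x ∉ Set.range v) :
    appendNode ι v x hx (Fin.last m) = ι x := Fin.Embedding.snoc_last

theorem notMem_range_appendNode (hι : ∀ a, a ∈ Set.range ι ↔ a ≠ k) {v : Fin m ↪ V} {x : V} (hx : x ∉ Set.range v) :
    k ∉ Set.range (appendNode ι v x hx) := by
  rintro ⟨p, hp⟩
  refine (hι k).1 ?_ rfl
  induction p using Fin.lastCases with
  | last => exact ⟨x, by rw [← hp, appendNode_last]⟩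
  | cast j => exact ⟨v j, by rw [← hp, appendNode, Fin.Embedding.snoc_castSucc]; rfl⟩

theorem dropNode_appendNode {v : Fin m ↪ V} {x : V} (hx : x ∉ Set.range v) :
    dropNode hι (appendNode ι v x hx) = v := by
  ext j
  apply ι.injective
  rw [dropNode_apply, dropPos_of_notMem (notMem_range_appendNode hι hx), Fin.succAbove_last,
    appendNode, Fin.Embedding.snoc_castSucc]
  rfl

theorem eq_appendNode {u : Fin (m + 1) ↪ α} (hu : k ∉ Set.range u) {x : V}
    (hx : ι x = u (Fin.last m)) :
    ∃ h : x ∉ Set.range (dropNode hι u), u = appendNode ι (dropNode hι u) x h := by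
  refine ⟨fun h => ((mem_range_dropNode_of_notMem hι hu).1 h).2 hx, ?_⟩
  ext p
  induction p using Fin.lastCases with
  | last => rw [appendNode_last, hx]
  | cast j =>
    rw [appendNode, Fin.Embedding.snoc_castSucc, Function.Embedding.trans_apply, dropNode_apply,
      dropPos_of_notMem hu, Fin.succAbove_last]

end Vectors

namespace CodedRebalancing

/-! ### Structured databases -/

open Database

section Structured

variable {V : Type} [Fintype V] {N r m s : ℕ}

theorem Database.isStructured_iff {C : Database V N} (hV : Fintype.card V = m + r) :
    C.IsStructured r ↔ ∃ (index : Fin N → (Fin m ↪ V)) (s : ℕ), UniformFibers index s ∧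
      ∀ n i, n ∈ C.store i ↔ i ∉ Set.range (index n) := by
  obtain rfl : m = Fintype.card V - r := by omega
  have : Nonempty (Fin (Fintype.card V - r) ↪ V) :=
    Function.Embedding.nonempty_of_card_le (by simp)
  constructor
  · rintro ⟨-, index, h1, h2⟩
    obtain ⟨s, hs⟩ := UniformFibers.of_ncard_eq h2
    exact ⟨index, s, hs, h1⟩
  · rintro ⟨index, s, h1, h2⟩
    exact ⟨by omega, index, h2, fun v w => (h1 v).trans (h1 w).symm⟩

theorem card_filter_notMem_range [DecidableEq V] (hV : Fintype.card V = m + r) (v : Fin m ↪ V)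
    [DecidablePred fun i => i ∉ Set.range v] :
    (Finset.univ.filter fun i => i ∉ Set.range v).card = r := by
  have : (Finset.univ.filter fun i => i ∉ Set.range v) = (Finset.univ.map v)ᶜ := by
    ext i
    simp
  rw [this, Finset.card_compl, Finset.card_map, Finset.card_univ, Fintype.card_fin, hV]
  omega

theorem exists_notMem_range (hr : 0 < r) (hV : Fintype.card V = m + r) (v : Fin m ↪ V) :
    ∃ i, i ∉ Set.range v := by
  classical
  obtain ⟨i, hi⟩ := Finset.card_pos.1 (hr.trans_eq (card_filter_notMem_range hV v).symm)
  exact ⟨i, (Finset.mem_filter.1 hi).2⟩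

/-- A node is avoided by some vector that leaves out at least one node. -/
theorem exists_notMem_range_of_lt (hm : m < Fintype.card V) (x : V) :
    ∃ v : Fin m ↪ V, x ∉ Set.range v := by
  classical
  obtain ⟨v⟩ : Nonempty (Fin m ↪ {y // y ≠ x}) :=
    Function.Embedding.nonempty_of_card_le (by simp; omega)
  refine ⟨v.trans (Function.Embedding.subtype _), ?_⟩
  rintro ⟨j, hj⟩
  exact (v j).2 hj

/-- Equal storage comes from symmetry: swapping `i` and `j` in all vectors lifts to a permutation of
the bits, because subfiles have equal size, and it carries one store onto the other. -/
theorem Database.IsStructured.isBalanced {C : Database V N} (h : C.IsStructured r) :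
    C.IsBalanced r := by
  classical
  have hV : Fintype.card V = (Fintype.card V - r) + r := (Nat.sub_add_cancel h.1).symm
  obtain ⟨index, s, hs, hst⟩ := (isStructured_iff hV).1 h
  constructor
  · intro n
    rw [replication, ← card_filter_notMem_range hV (index n)]
    congr 1
    ext i
    simp [hst]
  · intro i j
    obtain ⟨e, he⟩ := hs.exists_equiv
    let σ : (Fin (Fintype.card V - r) ↪ V) ≃ (Fin (Fintype.card V - r) ↪ V) :=
      Equiv.embeddingCongr (Equiv.refl _) (Equiv.swap i j)
    let π : Fin N ≃ Fin N := e.trans ((Equiv.prodCongrLeft fun _ => σ).trans e.symm)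
    have hπ : ∀ n, index (π n) = σ (index n) := fun n => by
      rw [← he, ← he]
      simp [π]
    refine Finset.card_equiv π fun n => ?_
    rw [hst, hst, hπ, not_iff_not]
    have hσ : ∀ p, σ (index n) p = Equiv.swap i j (index n p) := fun p => by
      simp [σ, Equiv.embeddingCongr]
    constructor
    · rintro ⟨p, hp⟩
      exact ⟨p, by rw [hσ, hp, Equiv.swap_apply_left]⟩
    · rintro ⟨p, hp⟩
      rw [hσ] at hp
      exact ⟨p, (Equiv.swap i j).injective (hp.trans (Equiv.swap_apply_left i j).symm)⟩

open scoped Classical in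
/-- The database in which a node stores the bits in whose vector it does not occur. -/
noncomputable def Database.ofIndex (hr : 0 < r) (hV : Fintype.card V = m + r)
    (index : Fin N → (Fin m ↪ V)) : Database V N where
  store i := Finset.univ.filter fun n => i ∉ Set.range (index n)
  cover n := by
    obtain ⟨i, hi⟩ := exists_notMem_range hr hV (index n)
    exact ⟨i, Finset.mem_filter.2 ⟨Finset.mem_univ _, hi⟩⟩

theorem Database.mem_store_ofIndex (hr : 0 < r) (hV : Fintype.card V = m + r)
    (index : Fin N → (Fin m ↪ V)) (n : Fin N) (i : V) :
    n ∈ (ofIndex hr hV index).store i ↔ i ∉ Set.range (index n) := by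
  classical
  simp [ofIndex]

theorem Database.isStructured_ofIndex (hr : 0 < r) (hV : Fintype.card V = m + r)
    {index : Fin N → (Fin m ↪ V)} (h : UniformFibers index s) :
    (ofIndex hr hV index).IsStructured r :=
  (isStructured_iff hV).2 ⟨index, s, h, mem_store_ofIndex hr hV index⟩

theorem Database.exists_isStructured (hr : 0 < r) (hV : Fintype.card V = m + r)
    (hN : N = (Fintype.card V).descFactorial m * s) :
    ∃ C : Database V N, C.IsStructured r := by
  classical
  have hc : Fintype.card (Fin N) = Fintype.card ((Fin m ↪ V) × Fin s) := by
    simp [hN, Fintype.card_embedding_eq]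
  have e := Fintype.equivOfCardEq hc
  exact ⟨_, isStructured_ofIndex hr hV (UniformFibers.of_equiv (f := fun n => (e n).1) e
    fun _ => rfl)⟩

end Structured

/-! ### Schemes built from XOR broadcasts and uncoded broadcasts -/

section Schemes

variable {K N : ℕ}

/-- A decoder exists as soon as the output is determined by the input. -/
theorem exists_decoder {Ω S O : Type*} [Nonempty O] (side : Ω → S) (out : Ω → O)
    (h : ∀ W W', side W = side W' → out W = out W') : ∃ dec : S → O, ∀ W, dec (side W) = out W :=
  ⟨Function.extend side out fun _ => Classical.arbitrary O, fun W =>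
    Function.FactorsThrough.extend_apply (fun _ _ hab => h _ _ hab) _ W⟩

open scoped Classical in
/-- The transmissions `μ : M`, each of which is the XOR over the set `A μ` of bits stored at the
node `sender μ`, make up a removal scheme if each survivor can pick its new bits out of them. -/
theorem exists_removalScheme {C : Database (Fin K) N} {k : Fin K}
    {T : Database {i : Fin K // i ≠ k} N} {M : Type*} [Fintype M]
    (sender : M → {i : Fin K // i ≠ k}) (A : M → Finset (Fin N))
    (hA : ∀ μ, A μ ⊆ C.store (sender μ).1) (hs : Function.Surjective sender)
    (hdec : ∀ j, ∀ n ∈ T.store j, n ∉ C.store j.1 →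
      ∃ μ, sender μ ≠ j ∧ n ∈ A μ ∧ ∀ m ∈ A μ, m ≠ n → m ∈ C.store j.1) :
    ∃ R : RemovalScheme C k T, ∑ i, R.len i = Fintype.card M ∧
      ∀ i t, ∃ μ, sender μ = i ∧ ∀ W, R.encode i (C.read i.1 W) t = ∑ n ∈ A μ, W n := by
  let len : {i : Fin K // i ≠ k} → ℕ := fun i => Fintype.card {μ // sender μ = i}
  let e : ∀ i, {μ // sender μ = i} ≃ Fin (len i) := fun i => Fintype.equivFin _
  have hA' : ∀ i t, A ((e i).symm t).1 ⊆ C.store i.1 := fun i t => by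
    have := hA ((e i).symm t).1
    rwa [((e i).symm t).2] at this
  let enc : ∀ i : {i : Fin K // i ≠ k}, C.Contents i.1 → (Fin (len i) → Bit) := fun i c t =>
    ∑ n ∈ (A ((e i).symm t).1).attach, c ⟨n.1, hA' i t n.2⟩
  have henc : ∀ i W t, enc i (C.read i.1 W) t = ∑ n ∈ A ((e i).symm t).1, W n := fun i W t =>
    Finset.sum_attach (A ((e i).symm t).1) W
  have hd : ∀ i : {i : Fin K // i ≠ k}, ∃ dec : C.Contents i.1 ×
      (∀ j : {j : {i : Fin K // i ≠ k} // j ≠ i}, Fin (len j.1) → Bit) → T.Contents i,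
      ∀ W, dec (C.read i.1 W, fun j => enc j.1 (C.read j.1.1 W)) = T.read i W := by
    intro i
    refine exists_decoder (fun W : File N => ((C.read i.1 W, fun j => enc j.1 (C.read j.1.1 W)) :
      C.Contents i.1 × (∀ j : {j : {i : Fin K // i ≠ k} // j ≠ i}, Fin (len j.1) → Bit)))
      (fun W => T.read i W) fun W W' h => ?_
    rw [Prod.mk.injEq] at h
    obtain ⟨h1, h2⟩ := h
    have h1 : ∀ n ∈ C.store i.1, W n = W' n := fun n hn => congrFun h1 ⟨n, hn⟩
    funext ⟨n, hn⟩
    change W n = W' n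
    by_cases hnC : n ∈ C.store i.1
    · exact h1 n hnC
    obtain ⟨μ, hμ, hnμ, hother⟩ := hdec i n hn hnC
    have h3 := congrFun (congrFun h2 ⟨sender μ, hμ⟩) (e _ ⟨μ, rfl⟩)
    simp only [henc, Equiv.symm_apply_apply] at h3
    rw [← Finset.add_sum_erase _ _ hnμ, ← Finset.add_sum_erase _ _ hnμ,
      Finset.sum_congr rfl fun m hm => h1 m (hother m (Finset.mem_of_mem_erase hm)
        (Finset.ne_of_mem_erase hm))] at h3
    exact add_right_cancel h3
  choose dec hdec' using hd
  refine ⟨⟨len, fun i => ?_, enc, fun i c w => dec i (c, w), hdec'⟩, ?_, fun i t =>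
    ⟨_, ((e i).symm t).2, fun W => henc i W t⟩⟩
  · obtain ⟨μ, hμ⟩ := hs i
    exact Fintype.card_pos_iff.2 ⟨⟨μ, hμ⟩⟩
  · change ∑ i, Fintype.card {μ // sender μ = i} = _
    rw [← Fintype.card_sigma]
    exact Fintype.card_congr (Equiv.sigmaFiberEquiv sender)

open scoped Classical in
/-- An addition scheme in which each bit of the new node is sent uncoded, by the node `sender n`. -/
theorem exists_additionScheme {C : Database (Fin K) N} {T : Database (Fin (K + 1)) N}
    (hT : ∀ i, T.store (Fin.castSucc i) ⊆ C.store i) (sender : T.store (Fin.last K) → Fin K)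
    (hC : ∀ n, n.1 ∈ C.store (sender n)) (hs : Function.Surjective sender) :
    ∃ R : AdditionScheme C T, ∑ i, R.len i = (T.store (Fin.last K)).card := by
  let len : Fin K → ℕ := fun i => Fintype.card {n // sender n = i}
  let e : ∀ i, {n // sender n = i} ≃ Fin (len i) := fun i => Fintype.equivFin _
  have hC' : ∀ i t, ((e i).symm t).1.1 ∈ C.store i := fun i t => by
    have := hC ((e i).symm t).1
    rwa [((e i).symm t).2] at this
  -- Old nodes only discard bits, so their decoders ignore the broadcasts.
  refine ⟨⟨len, fun i => ?_, fun i c t => c ⟨_, hC' i t⟩, fun i c _ n => c ⟨n.1, hT i n.2⟩,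
    fun w n => w (sender n) (e _ ⟨n, rfl⟩), fun i W => rfl, fun W => ?_⟩, ?_⟩
  · obtain ⟨n, hn⟩ := hs i
    exact Fintype.card_pos_iff.2 ⟨⟨n, hn⟩⟩
  · funext n
    simp [Database.read]
  · change ∑ i, Fintype.card {n // sender n = i} = _
    rw [← Fintype.card_sigma, Fintype.card_congr (Equiv.sigmaFiberEquiv sender),
      Fintype.card_coe]

end Schemes

/-! ### Optimal removal by coded exchange -/

section Removal

/-- A vector of nodes followed by a further node. -/
abbrev Extension (V : Type) (m : ℕ) : Type := {p : (Fin m ↪ V) × V // p.2 ∉ Set.range p.1}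

/-- A vector of nodes with two distinct extensions. -/
abbrev DoubleExtension (V : Type) (m : ℕ) : Type :=
  {p : (Fin m ↪ V) × V × V // p.2.1 ∉ Set.range p.1 ∧ p.2.2 ∉ Set.range p.1 ∧ p.2.1 ≠ p.2.2}

variable {V : Type} {m r : ℕ}

namespace DoubleExtension

/-- The first of the two extensions. -/
def fst (p : DoubleExtension V m) : Extension V m := ⟨(p.1.1, p.1.2.1), p.2.1⟩

/-- The second of the two extensions. -/
def snd (p : DoubleExtension V m) : Extension V m := ⟨(p.1.1, p.1.2.2), p.2.2.1⟩

/-- Exchange of the two extensions. -/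
def swap : DoubleExtension V m ≃ DoubleExtension V m where
  toFun p := ⟨(p.1.1, p.1.2.2, p.1.2.1), p.2.2.1, p.2.1, p.2.2.2.symm⟩
  invFun p := ⟨(p.1.1, p.1.2.2, p.1.2.1), p.2.2.1, p.2.1, p.2.2.2.symm⟩
  left_inv _ := rfl
  right_inv _ := rfl

theorem uniformFibers_fst [Fintype V] (hV : Fintype.card V = m + r) :
    UniformFibers (fst : DoubleExtension V m → Extension V m) (r - 1) := by
  classical
  rintro ⟨⟨v, x⟩, hx⟩
  have h1 : ((Finset.univ.filter fun i => i ∉ Set.range v).erase x).card = r - 1 := by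
    have hx' : x ∈ Finset.univ.filter fun i => i ∉ Set.range v :=
      Finset.mem_filter.2 ⟨Finset.mem_univ _, hx⟩
    rw [Finset.card_erase_of_mem hx',
      card_filter_notMem_range hV]
  rw [← h1, ← Set.ncard_coe_finset]
  refine Set.ncard_congr (fun p _ => p.1.2.2) ?_ ?_ ?_
  · rintro ⟨⟨v', x', y⟩, h⟩ hp
    simp only [fst, Set.mem_ofPred_eq, Subtype.mk.injEq, Prod.mk.injEq] at hp
    obtain ⟨rfl, rfl⟩ := hp
    simpa using And.intro h.2.1 h.2.2.symm
  · rintro ⟨⟨v', x', y⟩, h⟩ ⟨⟨v'', x'', y'⟩, h'⟩ hp hp' hy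
    simp only [fst, Set.mem_ofPred_eq, Subtype.mk.injEq, Prod.mk.injEq] at hp hp' hy
    obtain ⟨rfl, rfl⟩ := hp
    obtain ⟨rfl, rfl⟩ := hp'
    subst hy
    rfl
  · intro y hy
    have hy' : y ∉ Set.range v ∧ y ≠ x := by simpa using hy
    exact ⟨⟨(v, x, y), hx, hy'.1, hy'.2.symm⟩, rfl, rfl⟩

theorem uniformFibers_snd [Fintype V] (hV : Fintype.card V = m + r) :
    UniformFibers (snd : DoubleExtension V m → Extension V m) (r - 1) :=
  (uniformFibers_fst hV).comp_equiv swap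

end DoubleExtension

/-- The vectors that avoid a node correspond to the extensions over the other nodes. -/
theorem exists_lastExtension {α : Type} {k : α} {ι : V ↪ α}
    (hι : ∀ a, a ∈ Set.range ι ↔ a ≠ k) {D : Type*} [Finite D] {s : ℕ}
    {B : Type*} [Finite B] {index : B → (Fin (m + 1) ↪ α)} (hs : UniformFibers index s)
    (f : D ≃ {b // k ∉ Set.range (index b)}) :
    ∃ ext : D → Extension V m, UniformFibers ext s ∧
      ∀ d, (ext d).1.1 = dropNode hι (index (f d)) ∧
        ι (ext d).1.2 = index (f d) (Fin.last m) := by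
  have hx : ∀ d, ∃ x, ι x = index (f d) (Fin.last m) := fun d =>
    (hι _).2 fun h => (f d).2 ⟨_, h⟩
  choose x hx using hx
  have h := fun d => eq_appendNode hι (f d).2 (hx d)
  refine ⟨fun d => ⟨(dropNode hι (index (f d)), x d), (h d).1⟩, ?_, fun d => ⟨rfl, hx d⟩⟩
  rintro ⟨⟨v, y⟩, hy⟩
  rw [← hs (appendNode ι v y hy)]
  refine Set.ncard_congr (fun d _ => (f d).1) ?_ ?_ ?_
  · intro d hd
    simp only [Set.mem_ofPred_eq, Subtype.mk.injEq, Prod.mk.injEq] at hd ⊢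
    obtain ⟨h1, rfl⟩ := hd
    subst h1
    exact (h d).2
  · intro d d' _ _ hdd
    exact f.injective (Subtype.ext hdd)
  · intro b hb
    simp only [Set.mem_ofPred_eq] at hb
    have hk : k ∉ Set.range (index b) := by
      rw [hb]
      exact notMem_range_appendNode hι hy
    refine ⟨f.symm ⟨b, hk⟩, ?_, by simp⟩
    have h1 := hx (f.symm ⟨b, hk⟩)
    simp only [Equiv.apply_symm_apply, hb, appendNode_last] at h1
    simp only [Set.mem_ofPred_eq, Subtype.mk.injEq, Prod.mk.injEq, Equiv.apply_symm_apply]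
    refine ⟨?_, ι.injective h1⟩
    rw [hb, dropNode_appendNode]

theorem Database.IsStructured.exists_removal {r K N q : ℕ} (hr : 2 ≤ r) (hK : r + 1 ≤ K)
    (hN0 : 0 < N) (hN : N = K.descFactorial (K - r) * ((r - 1) * q)) {C : Database (Fin K) N}
    (hC : C.IsStructured r) (k : Fin K) :
    ∃ T : Database {i : Fin K // i ≠ k} N, T.IsStructured r ∧
      ∃ R : RemovalScheme C k T, R.IsXorExchange r ∧ R.load = 1 / ((r : ℝ) - 1) := by
  classical
  obtain ⟨m, hm⟩ : ∃ m, K = m + 1 + r := ⟨K - r - 1, by omega⟩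
  have hV : Fintype.card {i : Fin K // i ≠ k} = m + r := by simp; omega
  obtain ⟨index, s, hs, hst⟩ := (isStructured_iff (m := m + 1) (by simpa using hm)).1 hC
  have hs' : s = (r - 1) * q := by
    have h1 := hs.card_eq
    simp only [Nat.card_eq_fintype_card, Fintype.card_fin, Fintype.card_embedding_eq] at h1
    rw [show K - r = m + 1 by omega, h1] at hN
    exact Nat.eq_of_mul_eq_mul_left (Nat.descFactorial_pos.2 (by omega)) hN
  -- Positivity of `q` gives every survivor something to send, as codewords must be nonempty.
  have hq : 0 < q := by
    rcases Nat.eq_zero_or_pos q with rfl | h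
    · simp at hN
      omega
    · exact h
  have hι : ∀ a, a ∈ Set.range (Function.Embedding.subtype fun i : Fin K => i ≠ k) ↔ a ≠ k :=
    fun a => by simp
  set V := {i : Fin K // i ≠ k}
  let T : Database V N := ofIndex (by omega) hV fun n => dropNode hι (index n)
  have hT : T.IsStructured r :=
    isStructured_ofIndex _ _ ((uniformFibers_dropNode hι (by omega)).comp hs)
  have hTst : ∀ n i, n ∈ T.store i ↔ i ∉ Set.range (dropNode hι (index n)) :=
    mem_store_ofIndex _ _ _
  let f : C.store k ≃ {n // k ∉ Set.range (index n)} :=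
    Equiv.subtypeEquivRight fun n => hst n k
  have hf : ∀ d, (f d).1 = d.1 := fun _ => rfl
  obtain ⟨ext, hext, hext'⟩ := exists_lastExtension hι hs f
  simp only [hf] at hext'
  have hTold : ∀ n i, n ∉ C.store k → n ∈ T.store i → n ∈ C.store i.1 := by
    intro n i hn hi
    rw [hst, not_not] at hn
    rw [hTst, mem_range_dropNode_of_mem hι hn] at hi
    rwa [hst]
  have hTd : ∀ (d : C.store k) i, d.1 ∈ T.store i ↔ i ∉ Set.range (ext d).1.1 := fun d i => by
    rw [hTst, (hext' d).1]
  -- Together with `hTd`: among the survivors outside the vector `v` of a lost bit, only the deleted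
  -- entry `x` does not yet store it.
  have hCd : ∀ (d : C.store k) (i : V), d.1 ∈ C.store i.1 ↔
      i ∉ Set.range (ext d).1.1 ∧ i ≠ (ext d).1.2 := fun d i => by
    rw [hst, (hext' d).1, mem_range_dropNode_of_notMem hι ((hst _ _).1 d.2), ← (hext' d).2,
      (Function.Embedding.injective _).ne_iff]
    change i.1 ∉ _ ↔ ¬(i.1 ∈ _ ∧ _) ∧ _
    have : (ext d).1.2.1 ∈ Set.range (index d.1) := ⟨_, (hext' d).2.symm⟩
    by_cases h : i = (ext d).1.2
    · simp only [h, this]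
      simp
    · simp [h]
  rw [hs'] at hext
  -- Each lost bit of `(v, x)` gets a label `y ∉ v`, `y ≠ x`, and an index below `q`; the `r - 1`
  -- possible labels are why `r - 1` must divide the subfile size.
  obtain ⟨e, he⟩ := hext.exists_lift (DoubleExtension.uniformFibers_fst hV)
  let M := Extension V m × Fin q
  -- Forgetting the receiver `x` groups the bits `(v, x, y, t)` into the broadcast `(v, y, t)` of
  -- node `y`.
  let msg : C.store k → M := fun d => (DoubleExtension.snd (e d).1, (e d).2)
  have hmsg : UniformFibers msg (r - 1) := by
    obtain ⟨e', he'⟩ := (DoubleExtension.uniformFibers_snd hV).exists_equiv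
    refine UniformFibers.of_equiv (e.trans ((Equiv.prodCongrLeft fun _ => e').trans
      ((Equiv.prodAssoc _ _ _).trans ((Equiv.prodCongrRight fun _ => Equiv.prodComm _ _).trans
      (Equiv.prodAssoc _ _ _).symm)))) fun d => ?_
    simp [msg, he']
    rfl
  let A : M → Finset (Fin N) := fun μ =>
    (Finset.univ.filter fun d => msg d = μ).map (Function.Embedding.subtype _)
  have hmemA : ∀ μ n, n ∈ A μ ↔ ∃ d : C.store k, msg d = μ ∧ d.1 = n := fun μ n => by
    simp [A]
  have hAcard : ∀ μ, (A μ).card = r - 1 := fun μ => by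
    rw [Finset.card_map, ← hmsg μ, ← Set.ncard_coe_finset]
    simp
  have hvec : ∀ d, (ext d).1.1 = (msg d).1.1.1 := fun d => by rw [← he d]; rfl
  have hne : ∀ d, (ext d).1.2 ≠ (msg d).1.1.2 := fun d => by
    rw [← he d]
    exact (e d).1.2.2.2
  -- The receiver of a bit of a transmission stores all the other ones.
  have hother : ∀ d d' : C.store k, msg d' = msg d → d' ≠ d → d'.1 ∈ C.store (ext d).1.2.1 := by
    intro d d' hdd hnd
    have hv : (ext d').1.1 = (ext d).1.1 := by rw [hvec, hvec, hdd]
    rw [hCd, hv]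
    refine ⟨(ext d).2, fun hx => hnd (e.injective ?_)⟩
    have h1 := Prod.mk.inj hdd
    have h2 : DoubleExtension.fst (e d').1 = DoubleExtension.fst (e d).1 := by
      rw [he, he]
      exact Subtype.ext (Prod.ext hv hx.symm)
    refine Prod.ext (Subtype.ext (Prod.ext ?_ (Prod.ext ?_ ?_))) h1.2
    · exact congrArg (fun p : Extension V m => p.1.1) h2
    · exact congrArg (fun p : Extension V m => p.1.2) h2
    · exact congrArg (fun p : Extension V m => p.1.2) h1.1
  have hsend : ∀ μ, A μ ⊆ C.store μ.1.1.2.1 := by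
    intro μ n hn
    obtain ⟨d, rfl, rfl⟩ := (hmemA _ _).1 hn
    rw [hCd, hvec]
    exact ⟨(msg d).1.2, (hne d).symm⟩
  obtain ⟨R, hlen, henc⟩ := exists_removalScheme (T := T) (fun μ : M => μ.1.1.2) A hsend
    (fun x => by
      obtain ⟨v, hv⟩ := exists_notMem_range_of_lt (m := m) (by omega) x
      exact ⟨(⟨(v, x), hv⟩, ⟨0, hq⟩), rfl⟩)
    (fun j n hn hnC => by
      have hnk : n ∈ C.store k := by
        by_contra h
        exact hnC (hTold n j h hn)
      have hj : j = (ext ⟨n, hnk⟩).1.2 := by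
        by_contra h
        exact hnC ((hCd ⟨n, hnk⟩ j).2 ⟨(hTd ⟨n, hnk⟩ j).1 hn, h⟩)
      refine ⟨msg ⟨n, hnk⟩, ?_, (hmemA _ _).2 ⟨_, rfl, rfl⟩, ?_⟩
      · rw [hj]
        exact (hne _).symm
      · intro n' hn' hne'
        obtain ⟨d', hd', rfl⟩ := (hmemA _ _).1 hn'
        rw [hj]
        exact hother _ d' hd' fun h => hne' (by rw [h]))
  refine ⟨T, hT, R, ?_, ?_⟩
  · intro i t
    obtain ⟨μ, rfl, hμ⟩ := henc i t
    refine ⟨A μ, Finset.subset_inter (hsend μ) ?_, hAcard μ, ?_, hμ⟩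
    · intro n hn
      obtain ⟨d, -, rfl⟩ := (hmemA _ _).1 hn
      exact d.2
    · intro n hn
      obtain ⟨d, rfl, rfl⟩ := (hmemA _ _).1 hn
      refine ⟨(ext d).1.2, (hTd d _).2 (ext d).2, fun h => ((hCd d _).1 h).2 rfl, ?_⟩
      intro n' hn' hne'
      obtain ⟨d', hd', rfl⟩ := (hmemA _ _).1 hn'
      exact hother d d' hd' fun h => hne' (by rw [h])
  -- The messages partition the lost bits into groups of `r - 1`, so `|C_k| = (r - 1) |M|`.
  · have h1 := hmsg.card_eq
    rw [Nat.card_eq_fintype_card, Nat.card_eq_fintype_card, Fintype.card_coe] at h1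
    have hpos := hC.isBalanced.card_store_pos (by omega) hN0 k
    have hlen' : ∑ i, (R.len i : ℝ) = Fintype.card M := by exact_mod_cast hlen
    have h2 : ((r - 1 : ℕ) : ℝ) = (r : ℝ) - 1 := by rw [Nat.cast_sub (by omega)]; simp
    have hr0 : (r : ℝ) - 1 ≠ 0 := by
      rw [← h2]
      exact_mod_cast (by omega : r - 1 ≠ 0)
    have hM : (Fintype.card M : ℝ) ≠ 0 := by
      intro h
      have h : Fintype.card M = 0 := by exact_mod_cast h
      rw [h1, h] at hpos
      omega
    rw [RemovalScheme.load, hlen', h1]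
    push_cast
    rw [h2]
    field_simp

end Removal

/-! ### Optimal addition and the optimal load -/

theorem Database.IsStructured.exists_addition {r K N q : ℕ} (hr : 2 ≤ r) (hK : r + 1 ≤ K)
    (hN0 : 0 < N) (hN : N = K.descFactorial (K - r) * ((K + 1) * q)) {C : Database (Fin K) N}
    (hC : C.IsStructured r) :
    ∃ T : Database (Fin (K + 1)) N, T.IsStructured r ∧
      ∃ R : AdditionScheme C T, R.load = 1 := by
  classical
  obtain ⟨m, hm⟩ : ∃ m, K = m + r := ⟨K - r, by omega⟩
  obtain ⟨index, s, hs, hst⟩ := (isStructured_iff (m := m) (by simpa using hm)).1 hC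
  have hs' : s = (K + 1) * q := by
    have h1 := hs.card_eq
    simp only [Nat.card_eq_fintype_card, Fintype.card_fin, Fintype.card_embedding_eq] at h1
    rw [show K - r = m by omega, h1] at hN
    exact Nat.eq_of_mul_eq_mul_left (Nat.descFactorial_pos.2 (by omega)) hN
  have hq : 0 < q := by
    rcases Nat.eq_zero_or_pos q with rfl | h
    · simp at hN
      omega
    · exact h
  let ι : Fin K ↪ Fin (K + 1) := Fin.castSuccEmb
  have hι : ∀ a, a ∈ Set.range ι ↔ a ≠ Fin.last K := fun a => Fin.exists_castSucc_eq
  have hdrop := uniformFibers_dropNode (m := m) hι (by rw [Fintype.card_fin]; omega)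
  rw [Fintype.card_fin] at hdrop
  rw [hs'] at hs
  -- Each old subfile is split evenly among the `K + 1` longer vectors that delete to its vector.
  obtain ⟨e, he⟩ := hs.exists_lift hdrop
  have hV : Fintype.card (Fin (K + 1)) = (m + 1) + r := by rw [Fintype.card_fin]; omega
  let T : Database (Fin (K + 1)) N := ofIndex (by omega) hV fun n => (e n).1
  have hT : T.IsStructured r :=
    isStructured_ofIndex _ _ (UniformFibers.of_equiv e fun _ => rfl)
  have hTst : ∀ n i, n ∈ T.store i ↔ i ∉ Set.range (e n).1 := mem_store_ofIndex _ _ _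
  -- For a bit of the new node, deletion removes the last entry `x` of the new vector. Hence `x`
  -- stored the bit before the addition and can send it.
  have hx : ∀ n : T.store (Fin.last K), ∃ x, ι x = (e n.1).1 (Fin.last m) := fun n =>
    (hι _).2 fun h => (hTst _ _).1 n.2 ⟨_, h⟩
  choose sender hsender using hx
  obtain ⟨R, hR⟩ := exists_additionScheme (C := C) (T := T) (fun i n hn => by
      rw [hst, ← he, mem_range_dropNode]
      exact fun h => (hTst _ _).1 hn h.1) sender
    (fun n => by
      rw [hst, ← he, mem_range_dropNode_of_notMem hι ((hTst _ _).1 n.2)]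
      exact fun h => h.2 (hsender n))
    (fun x => by
      obtain ⟨v, hv⟩ := exists_notMem_range_of_lt (m := m) (by rw [Fintype.card_fin]; omega) x
      let n := e.symm (appendNode ι v x hv, ⟨0, hq⟩)
      have hn : (e n).1 = appendNode ι v x hv := by simp [n]
      have hmem : n ∈ T.store (Fin.last K) := by
        rw [hTst, hn]
        exact notMem_range_appendNode hι hv
      refine ⟨⟨n, hmem⟩, ι.injective ?_⟩
      rw [hsender, hn, appendNode_last])
  refine ⟨T, hT, R, ?_⟩
  have hpos := hT.isBalanced.card_store_pos (by omega) hN0 (Fin.last K)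
  rw [AdditionScheme.load, div_eq_one_iff_eq (by exact_mod_cast hpos.ne')]
  exact_mod_cast hR

/-- Exhibits the number `K! / r!` of vectors, leaving a subfile size divisible by `r - 1`, as
removal requires, and by `K + 1`, as addition requires. -/
theorem factorial_div_factorial_eq {r K : ℕ} (hK : r ≤ K) :
    (K + 1).factorial / r.factorial = (K + 1) * K.descFactorial (K - r) := by
  rw [← Nat.succ_descFactorial_succ, Nat.descFactorial_eq_div (by omega)]
  congr 2
  omega

theorem exists_optimal_design {r K N q : ℕ} (hr : 2 ≤ r) (hK : r + 1 ≤ K) (hN0 : 0 < N)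
    (hN : N = (r - 1) * ((K + 1).factorial / r.factorial) * q) :
    ∃ D : Design r K N,
      D.initial.IsStructured r ∧ (∀ k, (D.afterRemoval k).IsStructured r) ∧
      D.afterAddition.IsStructured r ∧
      (∀ k, (D.removal k).IsXorExchange r ∧ (D.removal k).load = 1 / ((r : ℝ) - 1)) ∧
      D.addition.load = 1 ∧ D.load = 1 / ((r : ℝ) - 1) + 1 := by
  rw [factorial_div_factorial_eq (by omega)] at hN
  have hV : Fintype.card (Fin K) = (K - r) + r := by rw [Fintype.card_fin]; omega
  obtain ⟨C, hC⟩ := exists_isStructured (N := N) (s := (r - 1) * ((K + 1) * q)) (by omega) hV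
    (by rw [Fintype.card_fin, hN]; ring)
  choose T hT R hR hRl using
    hC.exists_removal (q := (K + 1) * q) hr hK hN0 (by rw [hN]; ring)
  obtain ⟨T', hT', R', hR'⟩ :=
    hC.exists_addition (q := (r - 1) * q) hr hK hN0 (by rw [hN]; ring)
  have : Nonempty (Fin K) := ⟨⟨0, by omega⟩⟩
  refine ⟨⟨C, T, T', hC.isBalanced, fun k => (hT k).isBalanced, hT'.isBalanced, R, R'⟩,
    hC, hT, hT', fun k => ⟨hR k, hRl k⟩, hR', ?_⟩
  simp only [Design.load, hRl, hR', ciSup_const]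

end CodedRebalancing

theorem theorem1 (r K : ℕ) (hr : 2 ≤ r) (hK : r + 1 ≤ K) :
    -- Achievability by the structured class, which is closed under both operations.
    (∀ N : ℕ, 0 < N → (r - 1) * ((K + 1).factorial / r.factorial) ∣ N →
      (∃ C : CodedRebalancing.Database (Fin K) N, C.IsStructured r) ∧
      (∀ C : CodedRebalancing.Database (Fin K) N, C.IsStructured r →
        C.IsBalanced r ∧
        (∀ k : Fin K, ∃ T : CodedRebalancing.Database {i : Fin K // i ≠ k} N,
          T.IsStructured r ∧ T.IsBalanced r ∧
          ∃ R : CodedRebalancing.RemovalScheme C k T,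
            R.IsXorExchange r ∧ R.load = 1 / ((r : ℝ) - 1)) ∧
        (∃ T : CodedRebalancing.Database (Fin (K + 1)) N,
          T.IsStructured r ∧ T.IsBalanced r ∧
          ∃ R : CodedRebalancing.AdditionScheme C T, R.load = 1)) ∧
      (∃ D : CodedRebalancing.Design r K N,
        D.initial.IsStructured r ∧ (∀ k, (D.afterRemoval k).IsStructured r) ∧
        D.afterAddition.IsStructured r ∧
        (∀ k, (D.removal k).IsXorExchange r ∧ (D.removal k).load = 1 / ((r : ℝ) - 1)) ∧
        D.addition.load = 1 ∧
        D.load = 1 / ((r : ℝ) - 1) + 1) ∧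
      sInf (CodedRebalancing.loads r K N) = 1 / ((r : ℝ) - 1) + 1) ∧
    -- Converse, for every file size and all databases and schemes.
    (∀ N : ℕ, 0 < N → ∀ D : CodedRebalancing.Design r K N,
      1 / ((r : ℝ) - 1) + 1 ≤ D.load) ∧
    -- The optimal load, for the given number of nodes and over all numbers of nodes.
    CodedRebalancing.optimalLoadOn r K = 1 / ((r : ℝ) - 1) + 1 ∧
    CodedRebalancing.optimalLoad r = 1 / ((r : ℝ) - 1) + 1 := by
  have hle := fun {K' N : ℕ} (hK' : r + 1 ≤ K') (hN : 0 < N)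
    (D : CodedRebalancing.Design r K' N) => D.le_load hr (by omega) hN
  have hN₁ : 0 < (r - 1) * ((K + 1).factorial / r.factorial) := by
    refine Nat.mul_pos (by omega) (Nat.div_pos ?_ (Nat.factorial_pos r))
    exact Nat.factorial_le (by omega)
  -- The least admissible file size already attains both infima over file sizes.
  obtain ⟨D₁, -, -, -, -, -, hD₁⟩ :=
    CodedRebalancing.exists_optimal_design (q := 1) hr hK hN₁ (mul_one _).symm
  refine ⟨fun N hN hdvd => ?_, fun N hN D => hle hK hN D, ?_, ?_⟩
  · obtain ⟨q, hq⟩ := hdvd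
    obtain ⟨D, hD⟩ := CodedRebalancing.exists_optimal_design hr hK hN hq
    have hq' := hq
    rw [CodedRebalancing.factorial_div_factorial_eq (by omega)] at hq'
    refine ⟨⟨D.initial, hD.1⟩, fun C hC => ⟨hC.isBalanced, fun k => ?_, ?_⟩, ⟨D, hD⟩, ?_⟩
    · obtain ⟨T, hT, R, hR⟩ :=
        hC.exists_removal (q := (K + 1) * q) hr hK hN (by rw [hq']; ring) k
      exact ⟨T, hT, hT.isBalanced, R, hR⟩
    · obtain ⟨T, hT, R, hR⟩ :=
        hC.exists_addition (q := (r - 1) * q) hr hK hN (by rw [hq']; ring)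
      exact ⟨T, hT, hT.isBalanced, R, hR⟩
    · refine IsLeast.csInf_eq ⟨⟨D, hD.2.2.2.2.2⟩, ?_⟩
      rintro _ ⟨D', rfl⟩
      exact hle hK hN D'
  · refine IsLeast.csInf_eq ⟨⟨_, hN₁, D₁, hD₁⟩, ?_⟩
    rintro _ ⟨N, hN, D, rfl⟩
    exact hle hK hN D
  · refine IsLeast.csInf_eq ⟨⟨K, _, hK, hN₁, D₁, hD₁⟩, ?_⟩
    rintro _ ⟨K', N, hK', hN, D, rfl⟩
    exact hle hK' hN D
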